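/- Let $D,T>0$, let $V:\mathbb R\to\mathbb R$ be continuous and bounded below, and let $x:[0,T]\to\mathbb R$ be continuous. **Bayesian updates.** For $\varepsilon>0$ and $M>0$ let $$g_\varepsilon(q'|q)=\frac1{\sqrt{2\pi D\varepsilon}}\,e^{-(q'-q)^2/(2D\varepsilon)},\qquad \ell_\varepsilon(x|q)=M\,e^{-V(q-x)\,\varepsilon}$$ be the transition density of the Wiener process with diffusion constant $D$ and the exponential likelihood. Given a prior probability density $p_0$ and data $x_1,x_2,\dots$, the posterior densities are $p_i(q)=\frac{\ell_\varepsilon(x_i|q)}{Z_i}\int g_\varepsilon(q|q')\,p_{i-1}(q')\,dq'$, where $Z_i=\int \ell_\varepsilon(x_i|q)\int g_\varepsilon(q|q')\,p_{i-1}(q')\,dq'\,dq$ is the evidence $p(x_i)$ of the $i$-th datum (given the earlier ones). The kernel of $N\ge1$ updates is $$K_N(q_N,q_0;x_1,\dots,x_N)=\int dq_1\cdots\int dq_{N-1}\prod_{i=1}^N\frac{\ell_\varepsilon(x_i|q_i)}{Z_i}\,g_\varepsilon(q_i|q_{i-1}).$$ **Path integral.** Let $S[q]=\int_0^T\Big\{\frac{\dot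 q(t)^2}{2D}+V(q(t)-x(t))\Big\}\,dt$. For constants $A_N$, let $\int\mathcal D[q]\,e^{-S[q]}$ over paths from $q(0)=q_0$ to $q(T)=q_T$ be the limit as $N\to\infty$, if it exists, of $A_N\int dq(t_1)\cdots\int dq(t_{N-1})\,e^{-S[q]}$, where $t_i=iT/N$ and $q$ is the polygonal path with vertices $q(t_0)=q_0,\ q(t_1),\dots,q(t_{N-1}),\ q(t_N)=q_T$ at the times $t_0,\dots,t_N$. **(1) Discrete kernel.** For all $M,\varepsilon>0$, all data, every prior probability density $p_0$ and every $N\ge1$: all $Z_i>0$; $p_N(q)=\int K_N(q,q_0;x_1,\dots,x_N)\,p_0(q_0)\,dq_0$ for all $q$; and, with $\dot q_i=(q_i-q_{i-1})/\varepsilon$, $$K_N(q_N,q_0;x_1,\dots,x_N)=\Big(\prod_{i=1}^N\frac{M}{Z_i\sqrt{2\pi D\varepsilon}}\Big)\int dq_1\cdots\int dq_{N-1}\exp\Big[-\varepsilon\sum_{i=1}^N\Big\{\frac{\dot q_i^2}{2D}+V(q_i-x_i)\Big\}\Big],$$ where all the integrals converge. **(2) Continuum limit.** Take $\varepsilon=T/N$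 and $x_i=x(i\varepsilon)$. For all $q_T,q_0$ the path integral $\mathcal K(q_T,q_0)=\int\mathcal D[q]\,e^{-S[q]}$ with $A_N=(2\pi D\varepsilon)^{-N/2}$ exists and is positive, and $$\lim_{N\to\infty}(2\pi D\varepsilon)^{-N/2}\int dq_1\cdots\int dq_{N-1}\exp\Big[-\varepsilon\sum_{i=1}^N\Big\{\frac{\dot q_i^2}{2D}+V(q_i-x(i\varepsilon))\Big\}\Big]=\mathcal K(q_T,q_0),\qquad q_N=q_T .$$ Moreover, for every prior probability density $p_0$ and every choice of likelihood constants $M=M_\varepsilon>0$, the number $\mathcal Z=\iint\mathcal K(q,q_0)\,p_0(q_0)\,dq_0\,dq$ is finite and positive, and for all $q_T,q_0$ $$\lim_{N\to\infty}K_N(q_T,q_0;x(\varepsilon),\dots,x(N\varepsilon))=\frac{\mathcal K(q_T,q_0)}{\mathcal Z}=\int\mathcal D[q]\,e^{-S[q]},$$ where now $A_N=\prod_{i=1}^N M_\varepsilon/(Z_i\sqrt{2\pi D\varepsilon})$ is the prefactor of the kernel itself. -/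

import Mathlib

open MeasureTheory Filter Topology

noncomputable section

/-- Transition density `p(q', t + ε | q, t)` of the Wiener process with diffusion constant `D`:
the density at `q'` of the normal law with mean `q` and variance `D * ε`. -/
def wienerTransition (D ε q' q : ℝ) : ℝ :=
  ProbabilityTheory.gaussianPDFReal q (Real.toNNReal (D * ε)) q'

/-- The exponential likelihood `p(x | q) = M exp (-V (q - x) ε)`. -/
def expLikelihood (M : ℝ) (V : ℝ → ℝ) (ε x q : ℝ) : ℝ :=
  M * Real.exp (-(V (q - x) * ε))

/-- Law of total probability: density of the next state when the current one has density `p`. -/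
def predictiveDensity (D ε : ℝ) (p : ℝ → ℝ) (q : ℝ) : ℝ :=
  ∫ q', wienerTransition D ε q q' * p q'

/-- Probability density of the datum `x`, observed after one step started from the density `p`. -/
def evidence (M : ℝ) (V : ℝ → ℝ) (D ε x : ℝ) (p : ℝ → ℝ) : ℝ :=
  ∫ q, expLikelihood M V ε x q * predictiveDensity D ε p q

/-- One Bayesian update of the density `p` by the datum `x`. -/
def bayesUpdate (M : ℝ) (V : ℝ → ℝ) (D ε x : ℝ) (p : ℝ → ℝ) (q : ℝ) : ℝ :=
  expLikelihood M V ε x q / evidence M V D ε x p * predictiveDensity D ε p q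

/-- The posterior density after `n` Bayesian updates by the data `xs 1, …, xs n`,
started from the prior density `p₀`. -/
def posterior (M : ℝ) (V : ℝ → ℝ) (D ε : ℝ) (xs : ℕ → ℝ) (p₀ : ℝ → ℝ) : ℕ → ℝ → ℝ
  | 0 => p₀
  | n + 1 => bayesUpdate M V D ε (xs (n + 1)) (posterior M V D ε xs p₀ n)

/-- The evidence `p(x_i)` in the `i`-th update, `i ≥ 1`: the density of `xs i`
given the earlier data `xs 1, …, xs (i - 1)`. -/
def stepEvidence (M : ℝ) (V : ℝ → ℝ) (D ε : ℝ) (xs : ℕ → ℝ) (p₀ : ℝ → ℝ) (i : ℕ) : ℝ :=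
  evidence M V D ε (xs i) (posterior M V D ε xs p₀ (i - 1))

/-- The chain `q_0 = a, q_1, …, q_{N-1}, q_N = b` whose intermediate points `q_1, …, q_{N-1}` are
the coordinates of `y` (for `N ≥ 1`; beyond `N` it stays at `b`). -/
def chain (N : ℕ) (a b : ℝ) (y : Fin (N - 1) → ℝ) (i : ℕ) : ℝ :=
  if i = 0 then a else if h : i - 1 < N - 1 then y ⟨i - 1, h⟩ else b

/-- The kernel `K(q_N, q_0; x_1, …, x_N)` of `N` Bayesian updates, with final point `b = q_N`
and initial point `a = q_0`: the integral over `q_1, …, q_{N-1}` of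
`∏_{i=1}^N (p(x_i | q_i) / p(x_i)) p(q_i | q_{i-1})`. -/
def bayesKernel (M : ℝ) (V : ℝ → ℝ) (D ε : ℝ) (xs : ℕ → ℝ) (p₀ : ℝ → ℝ) (N : ℕ) (b a : ℝ) : ℝ :=
  ∫ y : Fin (N - 1) → ℝ, ∏ i ∈ Finset.Icc 1 N,
    expLikelihood M V ε (xs i) (chain N a b y i) / stepEvidence M V D ε xs p₀ i *
      wienerTransition D ε (chain N a b y i) (chain N a b y (i - 1))

/-- The discrete action `ε ∑_{i=1}^N {q̇_i² / (2D) + V (q_i - x_i)}`, `q̇_i = (q_i - q_{i-1}) / ε`,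
of a chain `z`. -/
def discreteAction (D : ℝ) (V : ℝ → ℝ) (ε : ℝ) (xs : ℕ → ℝ) (N : ℕ) (z : ℕ → ℝ) : ℝ :=
  ε * ∑ i ∈ Finset.Icc 1 N, (((z i - z (i - 1)) / ε) ^ 2 / (2 * D) + V (z i - xs i))

/-- The action `S = ∫_0^T {q̇(t)² / (2D) + V (q(t) - x(t))} dt` of a path `q`. -/
def onsagerMachlupAction (D : ℝ) (V x : ℝ → ℝ) (T : ℝ) (q : ℝ → ℝ) : ℝ :=
  ∫ t in (0 : ℝ)..T, ((deriv q t) ^ 2 / (2 * D) + V (q t - x t))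

/-- The polygonal path that passes through `z i` at time `i * ε` and is affine in between. -/
def polygonalPath (ε : ℝ) (z : ℕ → ℝ) (t : ℝ) : ℝ :=
  z ⌊t / ε⌋₊ + (t / ε - ⌊t / ε⌋₊) * (z (⌊t / ε⌋₊ + 1) - z ⌊t / ε⌋₊)

/-- The time-sliced path integral `A ∫ dq(t_1) ⋯ ∫ dq(t_{N-1}) F[q]`, `t_i = i T / N`, where `q` is
the polygonal path from `a` at time `0` to `b` at time `T` with vertices at the times `t_i`. -/
def slicedPathIntegral (A T : ℝ) (N : ℕ) (b a : ℝ) (F : (ℝ → ℝ) → ℝ) : ℝ :=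
  A * ∫ y : Fin (N - 1) → ℝ, F (polygonalPath (T / N) (chain N a b y))

/-- The path integral `∫ 𝒟[q] F[q]` over paths from `a` at time `0` to `b` at time `T` exists and
equals `L`, where `∫ 𝒟[q]` stands for the limit as `N → ∞` of
`A N * ∫ dq(t_1) ⋯ ∫ dq(t_{N-1})`. -/
def HasPathIntegral (A : ℕ → ℝ) (T b a : ℝ) (F : (ℝ → ℝ) → ℝ) (L : ℝ) : Prop :=
  Tendsto (fun N : ℕ => slicedPathIntegral (A N) T N b a F) atTop (𝓝 L)

/-- The factor in front of the multiple integral in the kernel: the product over the `N` steps of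
the normalization constants of the transition density and of the likelihood over the evidence. -/
def kernelPrefactor (M : ℝ) (V : ℝ → ℝ) (D ε : ℝ) (xs : ℕ → ℝ) (p₀ : ℝ → ℝ) (N : ℕ) : ℝ :=
  ∏ i ∈ Finset.Icc 1 N, M / (stepEvidence M V D ε xs p₀ i * √(2 * Real.pi * D * ε))

/-- The factor `(2 π D ε)^{-N/2}`, that is `M ^ N` with `M = (2 π D ε)^{-1/2}`. -/
def wienerPrefactor (D ε : ℝ) (N : ℕ) : ℝ :=
  (1 / √(2 * Real.pi * D * ε)) ^ N

/-- `p` is a probability density on the line. -/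
def IsProbDensity (p : ℝ → ℝ) : Prop :=
  (∀ q, 0 ≤ p q) ∧ Integrable p ∧ ∫ q, p q = 1

end

/-!
Both time-sliced path integrals and the Bayesian kernel are compositions of one-step kernels on the
line (`integral_chain_eq_iterKernel`), each of which is, up to normalization, dominated by
`exp (c * ε)` times the heat kernel of variance `D * ε`, where `-c` is a lower bound of the
potential. By the Chapman–Kolmogorov equation the compositions are dominated by `exp (c * T)` times
the heat kernel of variance `D * T`, uniformly in the number of steps. No measure on path space is
needed: every estimate is an inequality between Gaussian densities that is preserved by composition.

* *Localization* (`iterKernel_sub_le_mirrorKernel`). The contribution of the paths that leave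
  `[-R, R]` is bounded by heat kernels started at the mirror images of the initial point, which is
  the reflection principle as an inequality. It tends to `0` as `R → ∞`, uniformly in the number of
  steps. Hence the potential may be modified far away, and the limit is positive.
* *Perturbation* (`abs_iterKernel_sub_le`). One-step errors add up. A bounded uniformly continuous
  potential varies by at most `η + C * (b - a) ^ 2` along a step, and the quadratic term is absorbed
  by doubling the variance (`sq_mul_heatKernel_le`), with a gain of a factor of order `ε`.
  Therefore a step of the polygonal kernel, and any subdivision of a step of the Riemann kernel
  (`abs_iterKernel_riemannKernel_sub_le`), differ by `o(ε)` from the step with the potential frozen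
  at its starting point.

Comparing `N` and `N'` steps with their common refinement `N * N'`, the kernels form a Cauchy
sequence (`exists_tendsto_slicedKernel`); the polygonal ones have the same limit
(`tendsto_slicedPolygonKernel`). For the Bayesian kernel, the normalization of the posterior density
identifies the product of the evidences with the total mass of the unnormalized posterior
(`prod_div_stepEvidence_eq`), which converges by dominated convergence.
-/

/-! ### The heat kernel -/

/-- The centred Gaussian density of variance `v`, evaluated at `z`. -/
noncomputable def heatKernel (v z : ℝ) : ℝ :=
  (√(2 * Real.pi * v))⁻¹ * Real.exp (-z ^ 2 / (2 * v))

lemma heatKernel_eq_gaussianPDFReal {v : ℝ} (hv : 0 ≤ v) (b a : ℝ) :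
    heatKernel v (b - a) = ProbabilityTheory.gaussianPDFReal a v.toNNReal b := by
  simp [heatKernel, ProbabilityTheory.gaussianPDFReal, Real.coe_toNNReal v hv]

lemma wienerTransition_eq {D ε : ℝ} (hD : 0 < D) (hε : 0 < ε) (b a : ℝ) :
    wienerTransition D ε b a = heatKernel (D * ε) (b - a) :=
  (heatKernel_eq_gaussianPDFReal (by positivity) b a).symm

lemma heatKernel_nonneg (v z : ℝ) : 0 ≤ heatKernel v z := by
  unfold heatKernel; positivity

lemma heatKernel_pos {v : ℝ} (hv : 0 < v) (z : ℝ) : 0 < heatKernel v z := by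
  unfold heatKernel; positivity

lemma continuous_heatKernel (v : ℝ) : Continuous (heatKernel v) := by
  unfold heatKernel; fun_prop

lemma measurable_heatKernel (v : ℝ) : Measurable (heatKernel v) :=
  (continuous_heatKernel v).measurable

lemma heatKernel_le {v : ℝ} (hv : 0 < v) (z : ℝ) : heatKernel v z ≤ (√(2 * Real.pi * v))⁻¹ := by
  unfold heatKernel
  refine mul_le_of_le_one_right (by positivity) (Real.exp_le_one_iff.2 ?_)
  rw [neg_div]
  have : 0 ≤ z ^ 2 / (2 * v) := by positivity
  linarith

lemma heatKernel_le_of_sq_le {v : ℝ} (hv : 0 < v) {z z' : ℝ} (h : z' ^ 2 ≤ z ^ 2) :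
    heatKernel v z ≤ heatKernel v z' := by
  unfold heatKernel
  gcongr

lemma tendsto_heatKernel_cocompact {v : ℝ} (hv : 0 < v) :
    Tendsto (heatKernel v) (cocompact ℝ) (𝓝 0) := by
  have h : Tendsto (fun z : ℝ => z ^ 2 / (2 * v)) (cocompact ℝ) atTop := by
    have h1 : Tendsto (fun z : ℝ => ‖z‖ ^ 2) (cocompact ℝ) atTop :=
      (tendsto_pow_atTop two_ne_zero).comp (tendsto_norm_cocompact_atTop)
    simp only [Real.norm_eq_abs, sq_abs] at h1
    exact h1.atTop_div_const (by positivity)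
  have h2 := (Real.tendsto_exp_neg_atTop_nhds_zero.comp h).const_mul (√(2 * Real.pi * v))⁻¹
  rw [mul_zero] at h2
  refine h2.congr fun z => ?_
  simp only [heatKernel, Function.comp_apply, neg_div]

lemma integrable_heatKernel_sub {v : ℝ} (hv : 0 < v) (a : ℝ) :
    Integrable (fun b => heatKernel v (b - a)) := by
  simp_rw [heatKernel_eq_gaussianPDFReal hv.le]
  exact ProbabilityTheory.integrable_gaussianPDFReal a _

lemma integral_heatKernel_sub {v : ℝ} (hv : 0 < v) (a : ℝ) :
    ∫ b, heatKernel v (b - a) = 1 := by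
  simp_rw [heatKernel_eq_gaussianPDFReal hv.le]
  exact ProbabilityTheory.integral_gaussianPDFReal_eq_one a (by simpa using hv)

/-- Completing the square. -/
lemma heatKernel_mul_heatKernel {v w : ℝ} (hv : 0 < v) (hw : 0 < w) (b c a : ℝ) :
    heatKernel v (b - c) * heatKernel w (c - a) = heatKernel (v + w) (b - a) *
      heatKernel (v * w / (v + w)) (c - (w * b + v * a) / (v + w)) := by
  have h1 : (√(2 * Real.pi * v))⁻¹ * (√(2 * Real.pi * w))⁻¹ =
      (√(2 * Real.pi * (v + w)))⁻¹ * (√(2 * Real.pi * (v * w / (v + w))))⁻¹ := by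
    rw [← mul_inv, ← mul_inv, ← Real.sqrt_mul (by positivity), ← Real.sqrt_mul (by positivity)]
    congr 2
    field_simp
  have h2 : -(b - c) ^ 2 / (2 * v) + -(c - a) ^ 2 / (2 * w) = -(b - a) ^ 2 / (2 * (v + w)) +
      -(c - (w * b + v * a) / (v + w)) ^ 2 / (2 * (v * w / (v + w))) := by
    field_simp
    ring
  unfold heatKernel
  rw [mul_mul_mul_comm, ← Real.exp_add, h1, h2, Real.exp_add]
  ring

lemma integrable_heatKernel_mul {v w : ℝ} (hv : 0 < v) (hw : 0 < w) (b a : ℝ) :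
    Integrable (fun c => heatKernel v (b - c) * heatKernel w (c - a)) := by
  simp_rw [heatKernel_mul_heatKernel hv hw]
  exact (integrable_heatKernel_sub (by positivity) _).const_mul _

/-- The Chapman–Kolmogorov equation. -/
lemma integral_heatKernel_mul {v w : ℝ} (hv : 0 < v) (hw : 0 < w) (b a : ℝ) :
    ∫ c, heatKernel v (b - c) * heatKernel w (c - a) = heatKernel (v + w) (b - a) := by
  simp_rw [heatKernel_mul_heatKernel hv hw]
  rw [integral_const_mul, integral_heatKernel_sub (by positivity), mul_one]

/-- A quadratic factor costs one more unit of variance and gains a factor of the order of that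
variance. -/
lemma sq_mul_heatKernel_le {v w : ℝ} (hw : 0 < w) (hwv : w ≤ v) (z : ℝ) :
    z ^ 2 * heatKernel w z ≤ 8 * v * heatKernel (w + v) z := by
  have hv : 0 < v := hw.trans_le hwv
  have h1 : z ^ 2 * Real.exp (-z ^ 2 / (2 * w)) ≤
      2 * w * (w + v) / v * Real.exp (-z ^ 2 / (2 * (w + v))) := by
    set s := z ^ 2 * v / (2 * w * (w + v)) with hs
    have h : s * Real.exp (-s) ≤ 1 := by
      rw [Real.exp_neg, mul_inv_le_iff₀ (Real.exp_pos _), one_mul]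
      linarith [Real.add_one_le_exp s]
    have hz : z ^ 2 = 2 * w * (w + v) / v * s := by rw [hs]; field_simp
    have he : Real.exp (-z ^ 2 / (2 * w)) = Real.exp (-s) * Real.exp (-z ^ 2 / (2 * (w + v))) := by
      rw [← Real.exp_add]
      congr 1
      rw [hs]
      field_simp
      ring
    rw [he]
    calc z ^ 2 * (Real.exp (-s) * Real.exp (-z ^ 2 / (2 * (w + v))))
        = 2 * w * (w + v) / v * (s * Real.exp (-s)) * Real.exp (-z ^ 2 / (2 * (w + v))) := by
          nth_rewrite 1 [hz]; ring
      _ ≤ 2 * w * (w + v) / v * 1 * Real.exp (-z ^ 2 / (2 * (w + v))) := by gcongr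
      _ = _ := by ring
  have h2 : (√(2 * Real.pi * w))⁻¹ * (2 * w * (w + v) / v) ≤
      8 * v * (√(2 * Real.pi * (w + v)))⁻¹ := by
    have hsq : √(2 * Real.pi * (w + v)) * (w * (w + v)) ≤ √(2 * Real.pi * w) * (4 * v * v) := by
      refine le_of_sq_le_sq ?_ (by positivity)
      rw [mul_pow, mul_pow (√(2 * Real.pi * w)), Real.sq_sqrt (by positivity),
        Real.sq_sqrt (by positivity)]
      have : (w + v) * (w * (w + v)) ^ 2 ≤ w * (4 * v * v) ^ 2 := by
        have : (w + v) ^ 3 ≤ (2 * v) ^ 3 := by gcongr; linarith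
        calc (w + v) * (w * (w + v)) ^ 2 = w * (w * (w + v) ^ 3) := by ring
          _ ≤ w * (v * (2 * v) ^ 3) := by gcongr
          _ ≤ w * (4 * v * v) ^ 2 := by nlinarith [pow_pos hv 4, mul_pos hw (pow_pos hv 4)]
      nlinarith [Real.pi_pos]
    rw [inv_mul_eq_div, ← div_eq_mul_inv, div_le_div_iff₀ (by positivity) (by positivity),
      div_mul_eq_mul_div, div_le_iff₀ hv]
    linarith
  unfold heatKernel
  calc z ^ 2 * ((√(2 * Real.pi * w))⁻¹ * Real.exp (-z ^ 2 / (2 * w)))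
      = (√(2 * Real.pi * w))⁻¹ * (z ^ 2 * Real.exp (-z ^ 2 / (2 * w))) := by ring
    _ ≤ (√(2 * Real.pi * w))⁻¹ *
        (2 * w * (w + v) / v * Real.exp (-z ^ 2 / (2 * (w + v)))) := by gcongr
    _ = (√(2 * Real.pi * w))⁻¹ * (2 * w * (w + v) / v) *
        Real.exp (-z ^ 2 / (2 * (w + v))) := by ring
    _ ≤ 8 * v * (√(2 * Real.pi * (w + v)))⁻¹ * Real.exp (-z ^ 2 / (2 * (w + v))) := by gcongr
    _ = _ := by ring

/-! ### Kernels dominated by the heat kernel -/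

/-- Composition of two kernels on the line. -/
noncomputable def compKernel (k l : ℝ → ℝ → ℝ) (b a : ℝ) : ℝ := ∫ c, k b c * l c a

/-- The composition `k n ∘ ⋯ ∘ k 0` of `n + 1` kernels. -/
noncomputable def iterKernel (k : ℕ → ℝ → ℝ → ℝ) : ℕ → ℝ → ℝ → ℝ
  | 0 => k 0
  | n + 1 => compKernel (k (n + 1)) (iterKernel k n)

/-- A nonnegative measurable kernel bounded by `E` times the heat kernel of variance `v`. -/
structure HeatDominated (E v : ℝ) (k : ℝ → ℝ → ℝ) : Prop where
  measurable : Measurable (Function.uncurry k)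
  nonneg : ∀ b a, 0 ≤ k b a
  le : ∀ b a, k b a ≤ E * heatKernel v (b - a)

lemma HeatDominated.measurable_left {E v : ℝ} {k : ℝ → ℝ → ℝ} (hk : HeatDominated E v k) (a : ℝ) :
    Measurable (fun b => k b a) :=
  hk.measurable.comp (measurable_id.prodMk measurable_const)

lemma HeatDominated.measurable_right {E v : ℝ} {k : ℝ → ℝ → ℝ} (hk : HeatDominated E v k)
    (b : ℝ) : Measurable (fun a => k b a) :=
  hk.measurable.comp (measurable_const.prodMk measurable_id)

lemma HeatDominated.congr_const {E E' v v' : ℝ} {k : ℝ → ℝ → ℝ} (hk : HeatDominated E v k)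
    (hE : E = E') (hv : v = v') : HeatDominated E' v' k := hE ▸ hv ▸ hk

lemma heatDominated_heatKernel (v : ℝ) : HeatDominated 1 v (fun b a => heatKernel v (b - a)) where
  measurable := (measurable_heatKernel v).comp (measurable_fst.sub measurable_snd)
  nonneg _ _ := heatKernel_nonneg _ _
  le _ _ := (one_mul _).ge

lemma HeatDominated.mul_le {E E' v w : ℝ} {k l : ℝ → ℝ → ℝ} (hk : HeatDominated E v k)
    (hl : HeatDominated E' w l) (b c a : ℝ) :
    k b c * l c a ≤ E * E' * (heatKernel v (b - c) * heatKernel w (c - a)) := by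
  calc k b c * l c a ≤ E * heatKernel v (b - c) * (E' * heatKernel w (c - a)) :=
        mul_le_mul (hk.le _ _) (hl.le _ _) (hl.nonneg _ _) ((hk.nonneg _ _).trans (hk.le _ _))
    _ = _ := by ring

lemma HeatDominated.integrable_mul {E E' v w : ℝ} {k l : ℝ → ℝ → ℝ} (hv : 0 < v) (hw : 0 < w)
    (hk : HeatDominated E v k) (hl : HeatDominated E' w l) (b a : ℝ) :
    Integrable (fun c => k b c * l c a) := by
  refine ((integrable_heatKernel_mul hv hw b a).const_mul (E * E')).mono'
    ((hk.measurable_right b).mul (hl.measurable_left a)).aestronglyMeasurable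
    (Eventually.of_forall fun c => ?_)
  rw [Real.norm_of_nonneg (mul_nonneg (hk.nonneg _ _) (hl.nonneg _ _))]
  exact hk.mul_le hl b c a

lemma HeatDominated.comp {E E' v w : ℝ} {k l : ℝ → ℝ → ℝ} (hv : 0 < v) (hw : 0 < w)
    (hk : HeatDominated E v k) (hl : HeatDominated E' w l) :
    HeatDominated (E * E') (v + w) (compKernel k l) where
  measurable := by
    have h : StronglyMeasurable (fun p : (ℝ × ℝ) × ℝ => k p.1.1 p.2 * l p.2 p.1.2) :=
      ((hk.measurable.comp ((measurable_fst.comp measurable_fst).prodMk measurable_snd)).mul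
        (hl.measurable.comp
          (measurable_snd.prodMk (measurable_snd.comp measurable_fst)))).stronglyMeasurable
    exact h.integral_prod_right.measurable
  nonneg b a := integral_nonneg fun c => mul_nonneg (hk.nonneg _ _) (hl.nonneg _ _)
  le b a := by
    rw [← integral_heatKernel_mul hv hw, ← integral_const_mul]
    exact integral_mono (hk.integrable_mul hv hw hl b a)
      ((integrable_heatKernel_mul hv hw b a).const_mul _) fun c => hk.mul_le hl b c a

lemma compKernel_assoc {E₁ E₂ E₃ v₁ v₂ v₃ : ℝ} {k l m : ℝ → ℝ → ℝ} (h₁ : 0 < v₁) (h₂ : 0 < v₂)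
    (h₃ : 0 < v₃) (hk : HeatDominated E₁ v₁ k) (hl : HeatDominated E₂ v₂ l)
    (hm : HeatDominated E₃ v₃ m) :
    compKernel (compKernel k l) m = compKernel k (compKernel l m) := by
  funext b a
  have hmeas : Measurable (fun p : ℝ × ℝ => k b p.2 * l p.2 p.1 * m p.1 a) :=
    (((hk.measurable_right b).comp measurable_snd).mul (hl.measurable.comp measurable_swap)).mul
      ((hm.measurable_left a).comp measurable_fst)
  have hint : Integrable (Function.uncurry fun c d => k b d * l d c * m c a)
      (volume.prod volume) := by
    refine (integrable_prod_iff' hmeas.aestronglyMeasurable).2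
      ⟨Eventually.of_forall fun d => ?_, ?_⟩
    · simp only [mul_assoc]
      exact (hl.integrable_mul h₂ h₃ hm d a).const_mul _
    · refine (hk.integrable_mul h₁ (add_pos h₂ h₃) (hl.comp h₂ h₃ hm) b a).congr
        (Eventually.of_forall fun d => ?_)
      simp only [compKernel, ← integral_const_mul, ← mul_assoc]
      refine integral_congr_ae (Eventually.of_forall fun c => ?_)
      exact (Real.norm_of_nonneg (mul_nonneg (mul_nonneg (hk.nonneg _ _) (hl.nonneg _ _))
        (hm.nonneg _ _))).symm
  calc compKernel (compKernel k l) m b a = ∫ c, ∫ d, k b d * l d c * m c a := by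
        simp only [compKernel, integral_mul_const]
    _ = ∫ d, ∫ c, k b d * l d c * m c a := integral_integral_swap hint
    _ = compKernel k (compKernel l m) b a := by
        simp only [compKernel, ← integral_const_mul, mul_assoc]

lemma HeatDominated.iter {E v : ℝ} {k : ℕ → ℝ → ℝ → ℝ} (hv : 0 < v)
    (hk : ∀ i, HeatDominated E v (k i)) (n : ℕ) :
    HeatDominated (E ^ (n + 1)) ((n + 1) * v) (iterKernel k n) := by
  induction n with
  | zero => simpa [iterKernel] using hk 0
  | succ n ih =>
    refine ((hk (n + 1)).comp hv (by positivity) ih).congr_const (by ring) ?_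
    push_cast; ring

lemma iterKernel_heatKernel {v : ℝ} (hv : 0 < v) (n : ℕ) :
    iterKernel (fun _ b a => heatKernel v (b - a)) n =
      fun b a => heatKernel ((n + 1) * v) (b - a) := by
  induction n with
  | zero => simp [iterKernel]
  | succ n ih =>
    funext b a
    simp only [iterKernel, compKernel, ih]
    rw [integral_heatKernel_mul hv (by positivity)]
    congr 1; push_cast; ring

lemma iterKernel_const_mul (C : ℝ) (k : ℕ → ℝ → ℝ → ℝ) (n : ℕ) (b a : ℝ) :
    iterKernel (fun i b a => C * k i b a) n b a = C ^ (n + 1) * iterKernel k n b a := by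
  induction n generalizing b with
  | zero => simp [iterKernel]
  | succ n ih =>
    simp only [iterKernel, compKernel, ih, ← integral_const_mul]
    refine integral_congr_ae (Eventually.of_forall fun c => ?_)
    simp only
    ring

lemma iterKernel_add {E v : ℝ} {k : ℕ → ℝ → ℝ → ℝ} (hv : 0 < v)
    (hk : ∀ i, HeatDominated E v (k i)) (m n : ℕ) :
    iterKernel k (m + 1 + n) =
      compKernel (iterKernel (fun j => k (m + 1 + j)) n) (iterKernel k m) := by
  induction n with
  | zero => rfl
  | succ n ih =>
    rw [← Nat.add_assoc]
    simp only [iterKernel]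
    rw [ih, compKernel_assoc hv (by positivity) (by positivity) (hk _)
      (HeatDominated.iter hv (fun j => hk (m + 1 + j)) n) (HeatDominated.iter hv hk m)]
    simp only [Nat.add_assoc]

/-- Composing in blocks of `m + 1` kernels. -/
lemma iterKernel_block {E v : ℝ} {k : ℕ → ℝ → ℝ → ℝ} (hv : 0 < v)
    (hk : ∀ i, HeatDominated E v (k i)) (m n : ℕ) :
    iterKernel k (n * (m + 1) + m) =
      iterKernel (fun i => iterKernel (fun j => k (i * (m + 1) + j)) m) n := by
  induction n with
  | zero => simp [iterKernel]
  | succ n ih =>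
    have h := iterKernel_add hv hk (n * (m + 1) + m) m
    have e : n * (m + 1) + m + 1 = (n + 1) * (m + 1) := by ring
    rw [e] at h
    rw [h, ih]
    rfl

/-! ### Multiple integrals over chains -/

lemma chain_self (n : ℕ) (a b : ℝ) (y : Fin n → ℝ) : chain (n + 1) a b y (n + 1) = b := by
  simp [chain]

lemma chain_insertNth_last {n i : ℕ} (hi : i ≤ n + 1) (a b c : ℝ) (y : Fin n → ℝ) :
    chain (n + 2) a b ((MeasurableEquiv.piFinSuccAbove (fun _ => ℝ) (Fin.last n)).symm (c, y)) i =
      chain (n + 1) a c y i := by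
  have hY : (MeasurableEquiv.piFinSuccAbove (fun _ => ℝ) (Fin.last n)).symm (c, y) =
      (Fin.snoc y c : Fin (n + 1) → ℝ) := Fin.insertNth_last' c y
  rw [hY]
  rcases i with _ | j
  · simp [chain]
  · rcases (Nat.lt_succ_iff.1 (Nat.lt_succ_of_le (Nat.le_of_succ_le_succ hi))).lt_or_eq with h | h
    · have h1 : chain (n + 2) a b (Fin.snoc y c : Fin (n + 1) → ℝ) (j + 1) =
          (Fin.snoc y c : Fin (n + 1) → ℝ) (Fin.castSucc ⟨j, h⟩) := by
        simp only [chain, Nat.add_one_ne_zero, if_false, Nat.add_sub_cancel]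
        exact dif_pos (show j < n + 1 by omega)
      have h2 : chain (n + 1) a c y (j + 1) = y ⟨j, h⟩ := by
        simp only [chain, Nat.add_one_ne_zero, if_false, Nat.add_sub_cancel]
        exact dif_pos h
      rw [h1, h2]
      exact Fin.snoc_castSucc (α := fun _ => ℝ) c y ⟨j, h⟩
    · subst h
      have h1 : chain (j + 2) a b (Fin.snoc y c : Fin (j + 1) → ℝ) (j + 1) =
          (Fin.snoc y c : Fin (j + 1) → ℝ) (Fin.last j) := by
        simp only [chain, Nat.add_one_ne_zero, if_false, Nat.add_sub_cancel]
        exact dif_pos (Nat.lt_succ_self j)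
      rw [h1, chain_self]
      exact Fin.snoc_last (α := fun _ => ℝ) c y

lemma measurable_chain (N : ℕ) (a b : ℝ) (i : ℕ) :
    Measurable (fun y : Fin (N - 1) → ℝ => chain N a b y i) := by
  unfold chain
  split_ifs
  · exact measurable_const
  · exact measurable_pi_apply _
  · exact measurable_const

/-- Fubini's theorem: integrating a product of kernels along a chain over the intermediate points
gives the composition of these kernels. -/
lemma integral_chain_eq_iterKernel {E v : ℝ} {k : ℕ → ℝ → ℝ → ℝ} (hv : 0 < v)
    (hk : ∀ i, HeatDominated E v (k i)) (n : ℕ) (b a : ℝ) :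
    Integrable (fun y : Fin n → ℝ => ∏ i ∈ Finset.range (n + 1),
      k i (chain (n + 1) a b y (i + 1)) (chain (n + 1) a b y i)) ∧
    ∫ y : Fin n → ℝ, ∏ i ∈ Finset.range (n + 1),
      k i (chain (n + 1) a b y (i + 1)) (chain (n + 1) a b y i) = iterKernel k n b a := by
  induction n generalizing b with
  | zero =>
    have h : ∀ y : Fin 0 → ℝ, ∏ i ∈ Finset.range (0 + 1),
        k i (chain (0 + 1) a b y (i + 1)) (chain (0 + 1) a b y i) = k 0 b a := fun y => by
      simp [chain]
    simp_rw [h]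
    simp [iterKernel, measureReal_def, volume_pi]
  | succ n ih =>
    set e := MeasurableEquiv.piFinSuccAbove (fun _ : Fin (n + 1) => ℝ) (Fin.last n) with he
    have hmp : MeasurePreserving e.symm (volume.prod volume) volume :=
      (volume_preserving_piFinSuccAbove (fun _ : Fin (n + 1) => ℝ) (Fin.last n)).symm _
    set F : (Fin (n + 1) → ℝ) → ℝ := fun y => ∏ i ∈ Finset.range (n + 1 + 1),
      k i (chain (n + 1 + 1) a b y (i + 1)) (chain (n + 1 + 1) a b y i) with hF
    have hFe : ∀ c (y : Fin n → ℝ), F (e.symm (c, y)) = k (n + 1) b c *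
        ∏ i ∈ Finset.range (n + 1),
          k i (chain (n + 1) a c y (i + 1)) (chain (n + 1) a c y i) := fun c y => by
      simp only [hF]
      rw [Finset.prod_range_succ, mul_comm]
      congr 1
      · rw [he, chain_self (n + 1), chain_insertNth_last le_rfl, chain_self]
      · refine Finset.prod_congr rfl fun i hi => ?_
        have := Finset.mem_range.1 hi
        rw [he, chain_insertNth_last (by omega), chain_insertNth_last (by omega)]
    have hFmeas : Measurable F := Finset.measurable_prod _ fun i _ =>
      show Measurable (fun y : Fin (n + 1) → ℝ => Function.uncurry (k i)
          (chain (n + 1 + 1) a b y (i + 1), chain (n + 1 + 1) a b y i)) from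
        (hk i).measurable.comp ((measurable_chain (n + 1 + 1) a b _).prodMk
          (measurable_chain (n + 1 + 1) a b _))
    have hF0 : ∀ y, 0 ≤ F y := fun y => Finset.prod_nonneg fun i _ => (hk i).nonneg _ _
    have hcomp : Integrable (F ∘ e.symm) (volume.prod volume) := by
      refine (integrable_prod_iff (hFmeas.comp e.symm.measurable).aestronglyMeasurable).2
        ⟨Eventually.of_forall fun c => ?_, ?_⟩
      · simp only [Function.comp_apply, hFe]
        exact (ih c).1.const_mul _
      · simp only [Function.comp_apply, Real.norm_of_nonneg (hF0 _)]
        simp only [hFe, integral_const_mul, (ih _).2]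
        exact (hk _).integrable_mul hv (by positivity) (HeatDominated.iter hv hk n) b a
    refine ⟨(hmp.integrable_comp_emb e.symm.measurableEmbedding).1 hcomp, ?_⟩
    rw [← hmp.integral_comp e.symm.measurableEmbedding F]
    calc ∫ p, F (e.symm p) ∂(volume.prod volume) = ∫ c, ∫ y, F (e.symm (c, y)) :=
          integral_prod _ hcomp
      _ = iterKernel k (n + 1) b a := by
          simp only [hFe, integral_const_mul, (ih _).2, iterKernel, compKernel]

/-! ### Excursions and perturbations -/

/-- The sum of the heat kernels to `b` from the mirror images of `a` in the points `R` and `-R`. -/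
noncomputable def mirrorKernel (R v b a : ℝ) : ℝ :=
  heatKernel v (b - (2 * R - a)) + heatKernel v (b - (-(2 * R) - a))

lemma mirrorKernel_nonneg (R v b a : ℝ) : 0 ≤ mirrorKernel R v b a :=
  add_nonneg (heatKernel_nonneg _ _) (heatKernel_nonneg _ _)

lemma integrable_heatKernel_mul_mirrorKernel {v w : ℝ} (hv : 0 < v) (hw : 0 < w) (R b a : ℝ) :
    Integrable (fun c => heatKernel v (b - c) * mirrorKernel R w c a) := by
  simp only [mirrorKernel, mul_add]
  exact (integrable_heatKernel_mul hv hw b _).add (integrable_heatKernel_mul hv hw b _)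

lemma integral_heatKernel_mul_mirrorKernel {v w : ℝ} (hv : 0 < v) (hw : 0 < w) (R b a : ℝ) :
    ∫ c, heatKernel v (b - c) * mirrorKernel R w c a = mirrorKernel R (v + w) b a := by
  simp only [mirrorKernel, mul_add]
  rw [integral_add (integrable_heatKernel_mul hv hw b _) (integrable_heatKernel_mul hv hw b _),
    integral_heatKernel_mul hv hw, integral_heatKernel_mul hv hw]

lemma heatKernel_le_mirrorKernel {v R a c : ℝ} (hv : 0 < v) (ha : |a| ≤ R) (hc : R < |c|) :
    heatKernel v (c - a) ≤ mirrorKernel R v c a := by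
  obtain ⟨h1, h2⟩ := abs_le.1 ha
  rcases lt_abs.1 hc with h | h
  · refine (heatKernel_le_of_sq_le hv ?_).trans (le_add_of_nonneg_right (heatKernel_nonneg _ _))
    nlinarith
  · refine (heatKernel_le_of_sq_le hv ?_).trans (le_add_of_nonneg_left (heatKernel_nonneg _ _))
    nlinarith

lemma tendsto_mirrorKernel {v : ℝ} (hv : 0 < v) (b a : ℝ) :
    Tendsto (fun R => mirrorKernel R v b a) atTop (𝓝 0) := by
  have hR : Tendsto (fun R : ℝ => 2 * R) atTop atTop := tendsto_id.const_mul_atTop two_pos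
  have h1 : Tendsto (fun R : ℝ => b - (2 * R - a)) atTop (cocompact ℝ) := by
    have : Tendsto (fun R : ℝ => b + a + -(2 * R)) atTop atBot :=
      tendsto_atBot_add_const_left _ _ (tendsto_neg_atTop_atBot.comp hR)
    refine (this.mono_right atBot_le_cocompact).congr fun R => by ring
  have h2 : Tendsto (fun R : ℝ => b - (-(2 * R) - a)) atTop (cocompact ℝ) := by
    have : Tendsto (fun R : ℝ => b + a + 2 * R) atTop atTop :=
      tendsto_atTop_add_const_left _ _ hR
    refine (this.mono_right atTop_le_cocompact).congr fun R => by ring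
  simpa [mirrorKernel] using ((tendsto_heatKernel_cocompact hv).comp h1).add
    ((tendsto_heatKernel_cocompact hv).comp h2)

/-- The reflection principle as an inequality. If `k' ≤ k` as long as the path stays in `[-R, R]`,
then `k'` exceeds `k` by at most the mass that `k'` gives to the paths leaving `[-R, R]`. By
decomposition at the last visit outside, this is at most the heat kernel mass of the paths from the
mirror images of `a`, times the constants of domination. -/
lemma iterKernel_sub_le_mirrorKernel {E E' v R : ℝ} {k k' : ℕ → ℝ → ℝ → ℝ} (hv : 0 < v)
    (hE' : 0 ≤ E') (hk : ∀ i, HeatDominated E v (k i)) (hk' : ∀ i, HeatDominated E' v (k' i))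
    (hle : ∀ i b a, |b| ≤ R → |a| ≤ R → k' i b a ≤ k i b a) (n : ℕ) {b a : ℝ} (hb : |b| ≤ R)
    (ha : |a| ≤ R) :
    iterKernel k' n b a - iterKernel k n b a ≤
      E' ^ (n + 1) * mirrorKernel R ((n + 1) * v) b a := by
  induction n generalizing b with
  | zero =>
    exact (sub_nonpos.2 (hle 0 b a hb ha)).trans
      (mul_nonneg (by positivity) (mirrorKernel_nonneg _ _ _ _))
  | succ n ih =>
    have hw : 0 < ((n : ℝ) + 1) * v := by positivity
    have hi := HeatDominated.iter hv hk n
    have hi' := HeatDominated.iter hv hk' n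
    have e : ((n + 1 : ℕ) + 1 : ℝ) * v = v + (n + 1) * v := by push_cast; ring
    rw [e, ← integral_heatKernel_mul_mirrorKernel hv hw, ← integral_const_mul]
    simp only [iterKernel, compKernel]
    have h' := (hk' (n + 1)).integrable_mul hv hw hi' b a
    have h := (hk (n + 1)).integrable_mul hv hw hi b a
    rw [← integral_sub h' h]
    refine integral_mono (h'.sub h)
      ((integrable_heatKernel_mul_mirrorKernel hv hw R b a).const_mul _) fun c => ?_
    have hE : E' ^ (n + 1 + 1) * (heatKernel v (b - c) * mirrorKernel R ((n + 1) * v) c a) =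
      E' * heatKernel v (b - c) * (E' ^ (n + 1) * mirrorKernel R ((n + 1) * v) c a) := by ring
    simp only
    rw [hE]
    have hm := mirrorKernel_nonneg R ((n + 1) * v) c a
    rcases le_or_gt |c| R with hc | hc
    · calc k' (n + 1) b c * iterKernel k' n c a - k (n + 1) b c * iterKernel k n c a
          ≤ k' (n + 1) b c * iterKernel k' n c a - k' (n + 1) b c * iterKernel k n c a := by
            gcongr
            exacts [hi.nonneg _ _, hle _ _ _ hb hc]
        _ = k' (n + 1) b c * (iterKernel k' n c a - iterKernel k n c a) := by ring
        _ ≤ k' (n + 1) b c * (E' ^ (n + 1) * mirrorKernel R ((n + 1) * v) c a) :=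
            mul_le_mul_of_nonneg_left (ih hc) ((hk' _).nonneg _ _)
        _ ≤ _ := by
            gcongr
            exact (hk' _).le _ _
    · calc k' (n + 1) b c * iterKernel k' n c a - k (n + 1) b c * iterKernel k n c a
          ≤ k' (n + 1) b c * iterKernel k' n c a :=
            sub_le_self _ (mul_nonneg ((hk _).nonneg _ _) (hi.nonneg _ _))
        _ ≤ E' * heatKernel v (b - c) * (E' ^ (n + 1) * heatKernel ((n + 1) * v) (c - a)) := by
            have := heatKernel_nonneg v (b - c)
            gcongr
            exacts [hi'.nonneg _ _, (hk' _).le _ _, hi'.le _ _]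
        _ ≤ _ := by
            have := heatKernel_nonneg v (b - c)
            gcongr
            exact heatKernel_le_mirrorKernel hw ha hc

lemma abs_iterKernel_sub_le_mirrorKernel {E v R : ℝ} {k k' : ℕ → ℝ → ℝ → ℝ} (hv : 0 < v)
    (hE : 0 ≤ E) (hk : ∀ i, HeatDominated E v (k i)) (hk' : ∀ i, HeatDominated E v (k' i))
    (heq : ∀ i b a, |b| ≤ R → |a| ≤ R → k i b a = k' i b a) (n : ℕ) {b a : ℝ} (hb : |b| ≤ R)
    (ha : |a| ≤ R) :
    |iterKernel k n b a - iterKernel k' n b a| ≤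
      E ^ (n + 1) * mirrorKernel R ((n + 1) * v) b a :=
  abs_sub_le_iff.2
    ⟨iterKernel_sub_le_mirrorKernel hv hE hk' hk (fun i b a h h' => (heq i b a h h').le) n hb ha,
      iterKernel_sub_le_mirrorKernel hv hE hk hk' (fun i b a h h' => (heq i b a h h').ge) n hb ha⟩

/-- The splitting `k l - k' l' = k (l - l') + (k - k') l'` under the integral. -/
lemma abs_comp_sub_comp_le {k l k' l' : ℝ → ℝ → ℝ} {E₁ v₁ E₂ v₂ E₃ v₃ E₄ v₄ b a B : ℝ}
    {f : ℝ → ℝ} (h₁ : 0 < v₁) (h₂ : 0 < v₂) (h₃ : 0 < v₃) (h₄ : 0 < v₄)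
    (hk : HeatDominated E₁ v₁ k) (hl : HeatDominated E₂ v₂ l)
    (hk' : HeatDominated E₃ v₃ k') (hl' : HeatDominated E₄ v₄ l') (hf : Integrable f)
    (hfB : ∫ c, f c ≤ B)
    (h : ∀ c, |k b c * (l c a - l' c a)| + |k b c - k' b c| * l' c a ≤ f c) :
    |compKernel k l b a - compKernel k' l' b a| ≤ B := by
  unfold compKernel
  rw [← integral_sub (hk.integrable_mul h₁ h₂ hl b a) (hk'.integrable_mul h₃ h₄ hl' b a),
    ← Real.norm_eq_abs]
  refine (norm_integral_le_of_norm_le hf (Eventually.of_forall fun c => ?_)).trans hfB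
  refine le_trans ?_ (h c)
  rw [Real.norm_eq_abs, ← abs_of_nonneg (hl'.nonneg c a), ← abs_mul, abs_of_nonneg (hl'.nonneg c a)]
  refine le_trans (le_of_eq ?_) (abs_add_le _ _)
  congr 1
  ring

/-- Telescoping: a relative error `ρ` in each of the kernels adds up to at most `n + 1` times `ρ` in
the composition. -/
lemma abs_iterKernel_sub_le {E v ρ : ℝ} {k k' : ℕ → ℝ → ℝ → ℝ} (hv : 0 < v) (hE : 0 ≤ E)
    (hρ : 0 ≤ ρ) (hk : ∀ i, HeatDominated E v (k i)) (hk' : ∀ i, HeatDominated E v (k' i))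
    (n : ℕ)
    (h : ∀ i ≤ n, ∀ b a, |k i b a - k' i b a| ≤
      E * ρ * (heatKernel v (b - a) + heatKernel (2 * v) (b - a)))
    (b a : ℝ) :
    |iterKernel k n b a - iterKernel k' n b a| ≤ E ^ (n + 1) * ((n + 1) * ρ) *
      (heatKernel ((n + 1) * v) (b - a) + heatKernel ((n + 2) * v) (b - a)) := by
  induction n generalizing b with
  | zero => simpa [iterKernel] using h 0 le_rfl b a
  | succ n ih =>
    have ih := ih fun i hi => h i (hi.trans n.le_succ)
    have hw : 0 < ((n : ℝ) + 1) * v := by positivity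
    have hw' : 0 < ((n : ℝ) + 2) * v := by positivity
    have hi := HeatDominated.iter hv hk n
    have hi' := HeatDominated.iter hv hk' n
    have hE1 : 0 ≤ E ^ (n + 1) * (((n : ℝ) + 1) * ρ) := by positivity
    refine abs_comp_sub_comp_le hv hw hv hw (hk (n + 1)) hi (hk' (n + 1)) hi'
      (f := fun c => E ^ (n + 1 + 1) * ((n + 1) * ρ) *
          (heatKernel v (b - c) * heatKernel ((n + 1) * v) (c - a) +
            heatKernel v (b - c) * heatKernel ((n + 2) * v) (c - a)) +
        E ^ (n + 1 + 1) * ρ * (heatKernel v (b - c) * heatKernel ((n + 1) * v) (c - a) +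
            heatKernel (2 * v) (b - c) * heatKernel ((n + 1) * v) (c - a)))
      ?_ (le_of_eq ?_) fun c => ?_
    · exact (((integrable_heatKernel_mul hv hw b a).add
        (integrable_heatKernel_mul hv hw' b a)).const_mul _).add
        (((integrable_heatKernel_mul hv hw b a).add
        (integrable_heatKernel_mul (by positivity) hw b a)).const_mul _)
    · have i1 := integrable_heatKernel_mul hv hw b a
      have i2 := integrable_heatKernel_mul hv hw' b a
      have i3 := integrable_heatKernel_mul (v := 2 * v) (by positivity) hw b a
      rw [integral_add (by exact (i1.add i2).const_mul _) (by exact (i1.add i3).const_mul _),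
        integral_const_mul,
        integral_const_mul, integral_add i1 i2, integral_add i1 i3, integral_heatKernel_mul hv hw,
        integral_heatKernel_mul hv hw', integral_heatKernel_mul (by positivity) hw]
      have e1 : v + (n + 1) * v = ((n + 1 : ℕ) + 1 : ℝ) * v := by push_cast; ring
      have e2 : v + (n + 2) * v = ((n + 1 : ℕ) + 2 : ℝ) * v := by push_cast; ring
      have e3 : 2 * v + (n + 1) * v = ((n + 1 : ℕ) + 2 : ℝ) * v := by push_cast; ring
      rw [e1, e2, e3]
      push_cast
      ring
    · have g1 := heatKernel_nonneg v (b - c)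
      have g2 := heatKernel_nonneg (2 * v) (b - c)
      have g3 := heatKernel_nonneg ((n + 1) * v) (c - a)
      have g4 := heatKernel_nonneg ((n + 2) * v) (c - a)
      rw [abs_mul, abs_of_nonneg ((hk _).nonneg b c)]
      calc k (n + 1) b c * |iterKernel k n c a - iterKernel k' n c a| +
            |k (n + 1) b c - k' (n + 1) b c| * iterKernel k' n c a
          ≤ E * heatKernel v (b - c) * (E ^ (n + 1) * ((n + 1) * ρ) *
              (heatKernel ((n + 1) * v) (c - a) + heatKernel ((n + 2) * v) (c - a))) +
            E * ρ * (heatKernel v (b - c) + heatKernel (2 * v) (b - c)) *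
              (E ^ (n + 1) * heatKernel ((n + 1) * v) (c - a)) := by
            gcongr
            exacts [(hk _).le _ _, ih c, hi'.nonneg _ _, h _ le_rfl b c, hi'.le _ _]
        _ = _ := by ring

/-! ### The one-step kernels of the time-sliced path integrals -/

/-- The kernel of the time step from `i * ε` to `(i + 1) * ε`, the potential being evaluated at the
end point of the step. -/
noncomputable def riemannKernel (D : ℝ) (V : ℝ → ℝ) (ε : ℝ) (xs : ℕ → ℝ) (i : ℕ) (b a : ℝ) : ℝ :=
  heatKernel (D * ε) (b - a) * Real.exp (-(ε * V (b - xs (i + 1))))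

/-- The kernel of the time step from `i * ε` to `(i + 1) * ε`, the potential being averaged along
the segment from `a` to `b`. -/
noncomputable def polygonKernel (D : ℝ) (V x : ℝ → ℝ) (ε : ℝ) (i : ℕ) (b a : ℝ) : ℝ :=
  heatKernel (D * ε) (b - a) *
    Real.exp (-(ε * ∫ s in (0 : ℝ)..1, V (a + s * (b - a) - x (ε * (i + s)))))

/-- The kernel of the time step from `i * ε` to `(i + 1) * ε`, the potential being evaluated at the
starting point of the step. -/
noncomputable def frozenKernel (D : ℝ) (V x : ℝ → ℝ) (ε : ℝ) (i : ℕ) (b a : ℝ) : ℝ :=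
  heatKernel (D * ε) (b - a) * Real.exp (-(ε * V (a - x (i * ε))))

lemma heatDominated_mul_exp {v ε c : ℝ} (hε : 0 ≤ ε) {w : ℝ → ℝ → ℝ}
    (hw : Measurable (Function.uncurry w)) (hc : ∀ b a, -c ≤ w b a) :
    HeatDominated (Real.exp (c * ε)) v
      (fun b a => heatKernel v (b - a) * Real.exp (-(ε * w b a))) where
  measurable := ((measurable_heatKernel v).comp (measurable_fst.sub measurable_snd)).mul
    (Real.measurable_exp.comp (hw.const_mul ε).neg)
  nonneg _ _ := mul_nonneg (heatKernel_nonneg _ _) (Real.exp_nonneg _)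
  le b a := by
    rw [mul_comm]
    refine mul_le_mul_of_nonneg_right (Real.exp_le_exp.2 ?_) (heatKernel_nonneg _ _)
    nlinarith [hc b a]

lemma heatDominated_riemannKernel {D ε c : ℝ} {V : ℝ → ℝ} (hε : 0 ≤ ε) (hV : Continuous V)
    (hc : ∀ q, -c ≤ V q) (xs : ℕ → ℝ) (i : ℕ) :
    HeatDominated (Real.exp (c * ε)) (D * ε) (riemannKernel D V ε xs i) :=
  heatDominated_mul_exp hε (w := fun b _ => V (b - xs (i + 1)))
    (hV.measurable.comp (measurable_fst.sub_const _)) fun _ _ => hc _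

lemma heatDominated_frozenKernel {D ε c : ℝ} {V x : ℝ → ℝ} (hε : 0 ≤ ε) (hV : Continuous V)
    (hc : ∀ q, -c ≤ V q) (i : ℕ) :
    HeatDominated (Real.exp (c * ε)) (D * ε) (frozenKernel D V x ε i) :=
  heatDominated_mul_exp hε (w := fun _ a => V (a - x (i * ε)))
    (hV.measurable.comp (measurable_snd.sub_const _)) fun _ _ => hc _

lemma intervalIntegrable_segment {V x : ℝ → ℝ} (hV : Continuous V) (hx : Continuous x)
    (ε t b a : ℝ) :
    IntervalIntegrable (fun s => V (a + s * (b - a) - x (ε * (t + s)))) volume 0 1 :=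
  Continuous.intervalIntegrable (by fun_prop) _ _

lemma heatDominated_polygonKernel {D ε c : ℝ} {V x : ℝ → ℝ} (hε : 0 ≤ ε) (hV : Continuous V)
    (hx : Continuous x) (hc : ∀ q, -c ≤ V q) (i : ℕ) :
    HeatDominated (Real.exp (c * ε)) (D * ε) (polygonKernel D V x ε i) := by
  refine heatDominated_mul_exp hε
    (w := fun b a => ∫ s in (0 : ℝ)..1, V (a + s * (b - a) - x (ε * (i + s)))) ?_ fun b a => ?_
  · refine Continuous.measurable ?_
    exact intervalIntegral.continuous_parametric_intervalIntegral_of_continuous'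
      (f := fun (p : ℝ × ℝ) s => V (p.2 + s * (p.1 - p.2) - x (ε * (i + s)))) (by fun_prop) 0 1
  · have h := intervalIntegral.integral_mono_on (μ := volume) zero_le_one (f := fun _ => -c)
      intervalIntegrable_const
      (intervalIntegrable_segment hV hx ε i b a) fun s _ => hc _
    simpa using h

lemma abs_exp_neg_sub_exp_neg_le {m u w : ℝ} (hu : -m ≤ u) (hw : -m ≤ w) :
    |Real.exp (-u) - Real.exp (-w)| ≤ Real.exp m * |u - w| := by
  wlog h : u ≤ w generalizing u w
  · rw [abs_sub_comm, abs_sub_comm u]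
    exact this hw hu (le_of_not_ge h)
  have h1 : Real.exp (-w) = Real.exp (-u) * Real.exp (-(w - u)) := by
    rw [← Real.exp_add]; congr 1; ring
  have h2 : Real.exp (-w) ≤ Real.exp (-u) := Real.exp_le_exp.2 (by linarith)
  rw [abs_of_nonneg (sub_nonneg.2 h2), abs_sub_comm, abs_of_nonneg (sub_nonneg.2 h)]
  calc Real.exp (-u) - Real.exp (-w) = Real.exp (-u) * (1 - Real.exp (-(w - u))) := by
        rw [h1]; ring
    _ ≤ Real.exp m * (w - u) := by
        refine mul_le_mul (Real.exp_le_exp.2 (by linarith)) ?_ ?_ (Real.exp_nonneg _)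
        · linarith [Real.add_one_le_exp (-(w - u))]
        · exact sub_nonneg.2 (Real.exp_le_one_iff.2 (by linarith))

lemma abs_mul_exp_sub_mul_exp_le {g ε c r u w : ℝ} (hg : 0 ≤ g) (hε : 0 ≤ ε) (hu : -c ≤ u)
    (hw : -c ≤ w) (h : |u - w| ≤ r) :
    |g * Real.exp (-(ε * u)) - g * Real.exp (-(ε * w))| ≤ Real.exp (c * ε) * ε * (r * g) := by
  rw [← mul_sub, abs_mul, abs_of_nonneg hg]
  have h1 := abs_exp_neg_sub_exp_neg_le (m := c * ε) (u := ε * u) (w := ε * w) (by nlinarith)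
    (by nlinarith)
  rw [← mul_sub, abs_mul, abs_of_nonneg hε] at h1
  calc g * |Real.exp (-(ε * u)) - Real.exp (-(ε * w))|
      ≤ g * (Real.exp (c * ε) * (ε * r)) := by
        gcongr
        exact h1.trans (by gcongr)
    _ = _ := by ring

lemma quadratic_mul_heatKernel_le {η C v w : ℝ} (hC : 0 ≤ C) (hw : 0 < w) (hwv : w ≤ v) (z : ℝ) :
    (η + C * z ^ 2) * heatKernel w z ≤
      η * heatKernel w z + 8 * C * v * heatKernel (w + v) z := by
  nlinarith [mul_le_mul_of_nonneg_left (sq_mul_heatKernel_le hw hwv z) hC]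

lemma abs_polygonKernel_sub_frozenKernel_le {D ε c η C δ : ℝ} {V x : ℝ → ℝ} (hD : 0 < D)
    (hε : 0 < ε) (hV : Continuous V) (hx : Continuous x) (hc : ∀ q, -c ≤ V q) (hη : 0 ≤ η)
    (hC : 0 ≤ C)
    (hmod : ∀ b a s t, |s - t| ≤ δ → |V (b - x s) - V (a - x t)| ≤ η + C * (b - a) ^ 2)
    (hεδ : ε ≤ δ) (i : ℕ) (b a : ℝ) :
    |polygonKernel D V x ε i b a - frozenKernel D V x ε i b a| ≤
      Real.exp (c * ε) * (ε * (η + 8 * C * (D * ε))) *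
        (heatKernel (D * ε) (b - a) + heatKernel (2 * (D * ε)) (b - a)) := by
  have hv : 0 < D * ε := by positivity
  have hint := intervalIntegrable_segment hV hx ε i b a
  have hlow : -c ≤ ∫ s in (0 : ℝ)..1, V (a + s * (b - a) - x (ε * (i + s))) := by
    have h := intervalIntegral.integral_mono_on (μ := volume) zero_le_one (f := fun _ => -c)
      intervalIntegrable_const hint fun s _ => hc _
    simpa using h
  have hdiff : |(∫ s in (0 : ℝ)..1, V (a + s * (b - a) - x (ε * (i + s)))) - V (a - x (i * ε))| ≤
      η + C * (b - a) ^ 2 := by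
    have e : (∫ s in (0 : ℝ)..1, V (a + s * (b - a) - x (ε * (i + s)))) - V (a - x (i * ε)) =
        ∫ s in (0 : ℝ)..1, (V (a + s * (b - a) - x (ε * (i + s))) - V (a - x (i * ε))) := by
      rw [intervalIntegral.integral_sub hint intervalIntegrable_const]
      simp
    rw [e]
    have h := intervalIntegral.norm_integral_le_of_norm_le_const (a := 0) (b := 1)
      (C := η + C * (b - a) ^ 2)
      (f := fun s => V (a + s * (b - a) - x (ε * (i + s))) - V (a - x (i * ε))) fun s hs => by
        rw [Set.uIoc_of_le zero_le_one] at hs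
        refine (hmod _ a (ε * (i + s)) (i * ε) ?_).trans ?_
        · have : ε * (i + s) - i * ε = ε * s := by ring
          rw [this, abs_of_nonneg (mul_nonneg hε.le hs.1.le)]
          nlinarith [hs.2]
        · have : (a + s * (b - a) - a) ^ 2 = s ^ 2 * (b - a) ^ 2 := by ring
          rw [this]
          have : s ^ 2 ≤ 1 := pow_le_one₀ hs.1.le hs.2
          gcongr
          exact mul_le_of_le_one_left (sq_nonneg _) this
    simpa using h
  refine (abs_mul_exp_sub_mul_exp_le (heatKernel_nonneg _ _) hε.le hlow (hc _) hdiff).trans ?_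
  have h1 := quadratic_mul_heatKernel_le (η := η) hC hv le_rfl (b - a)
  rw [← two_mul] at h1
  have g1 := heatKernel_nonneg (D * ε) (b - a)
  have g2 := heatKernel_nonneg (2 * (D * ε)) (b - a)
  have h2 : 0 ≤ 8 * C * (D * ε) := by positivity
  calc Real.exp (c * ε) * ε * ((η + C * (b - a) ^ 2) * heatKernel (D * ε) (b - a))
      ≤ Real.exp (c * ε) * ε * ((η + 8 * C * (D * ε)) *
          (heatKernel (D * ε) (b - a) + heatKernel (2 * (D * ε)) (b - a))) := by
        refine mul_le_mul_of_nonneg_left (h1.trans ?_) (by positivity)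
        nlinarith [mul_nonneg h2 g1, mul_nonneg hη g2]
    _ = _ := by ring

/-- Freezing the potential at the starting point `a` of several steps, when it deviates from the
frozen value by at most `η + C * (b - a) ^ 2`. -/
lemma abs_iterKernel_sub_frozen_le {u h c η C v w₀ a : ℝ} {w : ℕ → ℝ → ℝ} (hu : 0 < u)
    (hh : 0 ≤ h) (hw : ∀ j, Measurable (w j)) (hc : ∀ j b, -c ≤ w j b) (hc₀ : -c ≤ w₀)
    (hη : 0 ≤ η) (hC : 0 ≤ C) (n : ℕ) (hnv : (n + 1) * u ≤ v)
    (hmod : ∀ j ≤ n, ∀ b, |w j b - w₀| ≤ η + C * (b - a) ^ 2) (b : ℝ) :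
    |iterKernel (fun j b a => heatKernel u (b - a) * Real.exp (-(h * w j b))) n b a -
        heatKernel ((n + 1) * u) (b - a) * Real.exp (-((n + 1) * h * w₀))| ≤
      Real.exp (c * h) ^ (n + 1) * ((n + 1) * h) *
        (η * heatKernel ((n + 1) * u) (b - a) +
          8 * C * v * heatKernel ((n + 1) * u + v) (b - a)) := by
  induction n generalizing b with
  | zero =>
    simp only [iterKernel, Nat.cast_zero, zero_add, one_mul, pow_one] at hnv ⊢
    refine (abs_mul_exp_sub_mul_exp_le (heatKernel_nonneg _ _) hh (hc 0 b) hc₀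
      (hmod 0 le_rfl b)).trans ?_
    gcongr
    exact quadratic_mul_heatKernel_le hC hu hnv _
  | succ n ih =>
    push_cast at hnv
    have hv : 0 < v := lt_of_lt_of_le (by positivity) hnv
    have ih := ih (by linarith) fun j hj => hmod j (hj.trans n.le_succ)
    have hu1 : 0 < ((n : ℝ) + 1) * u := by positivity
    have hu2 : 0 < ((n : ℝ) + 1) * u + v := by positivity
    have hk : ∀ j, HeatDominated (Real.exp (c * h)) u
        (fun b a => heatKernel u (b - a) * Real.exp (-(h * w j b))) := fun j =>
      heatDominated_mul_exp hh (w := fun b _ => w j b) ((hw j).comp measurable_fst)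
        fun _ _ => hc _ _
    have hk' : HeatDominated (Real.exp (c * h)) u
        (fun b a => heatKernel u (b - a) * Real.exp (-(h * w₀))) :=
      heatDominated_mul_exp hh (w := fun _ _ => w₀) measurable_const fun _ _ => hc₀
    have hl' : HeatDominated (Real.exp (c * ((n + 1) * h))) ((n + 1) * u)
        (fun b a => heatKernel ((n + 1) * u) (b - a) * Real.exp (-((n + 1) * h * w₀))) :=
      heatDominated_mul_exp (by positivity) (w := fun _ _ => w₀) measurable_const fun _ _ => hc₀
    have hEn : Real.exp (c * ((n + 1) * h)) = Real.exp (c * h) ^ (n + 1) := by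
      rw [← Real.exp_nat_mul]; congr 1; push_cast; ring
    set E := Real.exp (c * h) with hE
    have hE0 : 0 ≤ E := Real.exp_nonneg _
    have htarget : heatKernel (((n + 1 : ℕ) + 1) * u) (b - a) *
        Real.exp (-(((n + 1 : ℕ) + 1) * h * w₀)) =
        compKernel (fun b a => heatKernel u (b - a) * Real.exp (-(h * w₀)))
          (fun b a => heatKernel ((n + 1) * u) (b - a) * Real.exp (-((n + 1) * h * w₀))) b a := by
      have e : ∀ c, heatKernel u (b - c) * Real.exp (-(h * w₀)) *
          (heatKernel ((n + 1) * u) (c - a) * Real.exp (-((n + 1) * h * w₀))) =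
          heatKernel u (b - c) * heatKernel ((n + 1) * u) (c - a) *
            Real.exp (-(((n + 1 : ℕ) + 1) * h * w₀)) := fun c => by
        rw [mul_mul_mul_comm, ← Real.exp_add]
        congr 2; push_cast; ring
      simp only [compKernel, e]
      rw [integral_mul_const, integral_heatKernel_mul hu hu1]
      congr 2; push_cast; ring
    rw [htarget]
    set Q := η + C * (b - a) ^ 2 with hQ
    have i1 := integrable_heatKernel_mul hu hu1 b a
    have i2 := integrable_heatKernel_mul hu hu2 b a
    refine abs_comp_sub_comp_le hu hu1 hu hu1 (hk (n + 1)) (HeatDominated.iter hu hk n) hk' hl'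
      (f := fun d => E ^ (n + 2) * ((n + 1) * h) *
          (η * (heatKernel u (b - d) * heatKernel ((n + 1) * u) (d - a)) +
            8 * C * v * (heatKernel u (b - d) * heatKernel ((n + 1) * u + v) (d - a))) +
        E ^ (n + 2) * h * Q * (heatKernel u (b - d) * heatKernel ((n + 1) * u) (d - a)))
      ?_ ?_ fun d => ?_
    · exact (((i1.const_mul η).add (i2.const_mul _)).const_mul _).add (i1.const_mul _)
    · rw [integral_add (by exact ((i1.const_mul η).add (i2.const_mul _)).const_mul _)
        (i1.const_mul _), integral_const_mul, integral_const_mul,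
        integral_add (i1.const_mul η) (i2.const_mul _), integral_const_mul, integral_const_mul,
        integral_heatKernel_mul hu hu1, integral_heatKernel_mul hu hu2]
      have e1 : u + (n + 1) * u = ((n + 1 : ℕ) + 1 : ℝ) * u := by push_cast; ring
      have e2 : u + ((n + 1) * u + v) = ((n + 1 : ℕ) + 1 : ℝ) * u + v := by push_cast; ring
      rw [e1, e2]
      have h1 := quadratic_mul_heatKernel_le (η := η) (w := ((n + 1 : ℕ) + 1 : ℝ) * u) hC
        (by positivity) (by push_cast; exact hnv) (b - a)
      have h2 : 0 ≤ E ^ (n + 2) * h := by positivity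
      have h3 := mul_le_mul_of_nonneg_left h1 h2
      push_cast at h3 ⊢
      linarith
    · have g1 := heatKernel_nonneg u (b - d)
      have g2 := heatKernel_nonneg ((n + 1) * u) (d - a)
      have hkd := hk (n + 1)
      rw [abs_mul, abs_of_nonneg (hkd.nonneg b d)]
      calc _ ≤ E * heatKernel u (b - d) * (E ^ (n + 1) * ((n + 1) * h) *
              (η * heatKernel ((n + 1) * u) (d - a) +
                8 * C * v * heatKernel ((n + 1) * u + v) (d - a))) +
            E * h * (Q * heatKernel u (b - d)) *
              (E ^ (n + 1) * heatKernel ((n + 1) * u) (d - a)) := by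
            have := hmod (n + 1) le_rfl b
            have hQ0 : 0 ≤ Q := by positivity
            refine add_le_add (mul_le_mul (hkd.le b d) (ih d) (abs_nonneg _) (by positivity))
              (mul_le_mul (abs_mul_exp_sub_mul_exp_le g1 hh (hc _ _) hc₀ this) ?_
                (hl'.nonneg _ _) (by positivity))
            rw [← hEn]
            exact hl'.le d a
        _ = _ := by ring

/-! ### Convergence of the time-sliced kernels -/

lemma uniformContinuous_IccExtend {a b : ℝ} (h : a ≤ b) {f : Set.Icc a b → ℝ} (hf : Continuous f) :
    UniformContinuous (Set.IccExtend h f) :=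
  (CompactSpace.uniformContinuous_of_continuous hf).comp (LipschitzWith.projIcc h).uniformContinuous

lemma exists_abs_IccExtend_le {a b : ℝ} (h : a ≤ b) {f : Set.Icc a b → ℝ} (hf : Continuous f) :
    ∃ L, ∀ q, |Set.IccExtend h f q| ≤ L := by
  obtain ⟨L, hL⟩ := (isCompact_range hf).isBounded.exists_norm_le
  exact ⟨L, fun q => hL _ ⟨_, rfl⟩⟩

/-- A modulus of continuity in quadratic form: a bounded uniformly continuous function varies by at
most `η` over short distances and by at most a multiple of the squared distance over long ones. -/
lemma exists_quadratic_modulus {W x : ℝ → ℝ} {L η : ℝ} (hW : UniformContinuous W)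
    (hL : ∀ q, |W q| ≤ L) (hx : UniformContinuous x) (hη : 0 < η) :
    ∃ C δ : ℝ, 0 ≤ C ∧ 0 < δ ∧ ∀ b a s t, |s - t| ≤ δ →
      |W (b - x s) - W (a - x t)| ≤ η + C * (b - a) ^ 2 := by
  obtain ⟨ρ, hρ, hWρ⟩ := Metric.uniformContinuous_iff.1 hW η hη
  obtain ⟨δ, hδ, hxδ⟩ := Metric.uniformContinuous_iff.1 hx (ρ / 2) (by positivity)
  have hL0 : 0 ≤ L := (abs_nonneg _).trans (hL 0)
  refine ⟨8 * L / ρ ^ 2, δ / 2, by positivity, by positivity, fun b a s t hst => ?_⟩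
  have hxst : |x s - x t| < ρ / 2 := hxδ (by rw [Real.dist_eq]; linarith)
  rcases lt_or_ge |b - a| (ρ / 2) with h | h
  · have h1 : |W (b - x s) - W (a - x t)| < η := hWρ (by
      rw [Real.dist_eq]
      calc |b - x s - (a - x t)| = |(b - a) - (x s - x t)| := by congr 1; ring
        _ ≤ |b - a| + |x s - x t| := abs_sub _ _
        _ < ρ := by linarith)
    have : 0 ≤ 8 * L / ρ ^ 2 * (b - a) ^ 2 := by positivity
    linarith
  · have h1 : |W (b - x s) - W (a - x t)| ≤ 2 * L :=
      (abs_sub _ _).trans (by linarith [hL (b - x s), hL (a - x t)])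
    have h2 : (ρ / 2) ^ 2 ≤ (b - a) ^ 2 := by
      rw [← sq_abs (b - a)]; gcongr
    have h3 : 2 * L ≤ 8 * L / ρ ^ 2 * (b - a) ^ 2 := by
      calc 2 * L = 8 * L / ρ ^ 2 * (ρ / 2) ^ 2 := by field_simp; ring
        _ ≤ _ := by gcongr
    linarith

section Frozen

variable {D T ε c η C δ : ℝ} {W x : ℝ → ℝ} {n : ℕ}

lemma abs_iterKernel_sub_iterKernel_frozenKernel_le (hD : 0 < D) (hε : 0 < ε)
    (hT : ((n : ℝ) + 1) * ε = T) (hW : Continuous W) (hc : ∀ q, -c ≤ W q) (hη : 0 ≤ η)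
    (hC : 0 ≤ C) {k : ℕ → ℝ → ℝ → ℝ} (hk : ∀ i, HeatDominated (Real.exp (c * ε)) (D * ε) (k i))
    (h : ∀ i ≤ n, ∀ b a, |k i b a - frozenKernel D W x ε i b a| ≤
      Real.exp (c * ε) * (ε * (η + 8 * C * (D * ε))) *
        (heatKernel (D * ε) (b - a) + heatKernel (2 * (D * ε)) (b - a))) (b a : ℝ) :
    |iterKernel k n b a - iterKernel (frozenKernel D W x ε) n b a| ≤
      Real.exp (c * T) * T * (2 * (√(2 * Real.pi * (D * T)))⁻¹) * (η + 8 * C * (D * ε)) := by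
  have hT0 : 0 < T := hT ▸ by positivity
  refine (abs_iterKernel_sub_le (by positivity) (Real.exp_nonneg _) (by positivity) hk
    (heatDominated_frozenKernel hε.le hW hc) n h b a).trans ?_
  have e1 : Real.exp (c * ε) ^ (n + 1) = Real.exp (c * T) := by
    rw [← Real.exp_nat_mul, ← hT]; congr 1; push_cast; ring
  have e2 : ((n : ℝ) + 1) * (D * ε) = D * T := by rw [← hT]; ring
  have e3 : ((n : ℝ) + 2) * (D * ε) = D * T + D * ε := by rw [← hT]; ring
  have h1 : heatKernel (D * T) (b - a) ≤ (√(2 * Real.pi * (D * T)))⁻¹ :=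
    heatKernel_le (by positivity) _
  have h2 : heatKernel (D * T + D * ε) (b - a) ≤ (√(2 * Real.pi * (D * T)))⁻¹ := by
    refine (heatKernel_le (by positivity) _).trans ?_
    gcongr
    exact le_add_of_nonneg_right (by positivity)
  have e4 : ((n : ℝ) + 1) * (ε * (η + 8 * C * (D * ε))) = T * (η + 8 * C * (D * ε)) := by
    rw [← mul_assoc, hT]
  rw [e1, e2, e3, e4]
  calc Real.exp (c * T) * (T * (η + 8 * C * (D * ε))) *
        (heatKernel (D * T) (b - a) + heatKernel (D * T + D * ε) (b - a))
      ≤ Real.exp (c * T) * (T * (η + 8 * C * (D * ε))) *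
        ((√(2 * Real.pi * (D * T)))⁻¹ + (√(2 * Real.pi * (D * T)))⁻¹) := by gcongr
    _ = _ := by ring

lemma abs_iterKernel_polygonKernel_sub_le (hD : 0 < D) (hε : 0 < ε)
    (hT : ((n : ℝ) + 1) * ε = T) (hW : Continuous W) (hx : Continuous x) (hc : ∀ q, -c ≤ W q)
    (hη : 0 ≤ η) (hC : 0 ≤ C)
    (hmod : ∀ b a s t, |s - t| ≤ δ → |W (b - x s) - W (a - x t)| ≤ η + C * (b - a) ^ 2)
    (hεδ : ε ≤ δ) (b a : ℝ) :
    |iterKernel (polygonKernel D W x ε) n b a - iterKernel (frozenKernel D W x ε) n b a| ≤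
      Real.exp (c * T) * T * (2 * (√(2 * Real.pi * (D * T)))⁻¹) * (η + 8 * C * (D * ε)) :=
  abs_iterKernel_sub_iterKernel_frozenKernel_le hD hε hT hW hc hη hC
    (heatDominated_polygonKernel hε.le hW hx hc)
    (fun i _ => abs_polygonKernel_sub_frozenKernel_le hD hε hW hx hc hη hC hmod hεδ i) b a

/-- The kernel with `(n + 1) * (m + 1)` time steps is close to the one with `n + 1` time steps and
frozen potential, uniformly in `m`. -/
lemma abs_iterKernel_riemannKernel_sub_le {h : ℝ} {m : ℕ} (hD : 0 < D) (hh : 0 < h)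
    (hε : ((m : ℝ) + 1) * h = ε) (hT : ((n : ℝ) + 1) * ε = T) (hW : Continuous W)
    (hc : ∀ q, -c ≤ W q) (hη : 0 ≤ η) (hC : 0 ≤ C)
    (hmod : ∀ b a s t, |s - t| ≤ δ → |W (b - x s) - W (a - x t)| ≤ η + C * (b - a) ^ 2)
    (hεδ : ε ≤ δ) (b a : ℝ) :
    |iterKernel (riemannKernel D W h (fun i => x (i * h))) (n * (m + 1) + m) b a -
        iterKernel (frozenKernel D W x ε) n b a| ≤
      Real.exp (c * T) * T * (2 * (√(2 * Real.pi * (D * T)))⁻¹) * (η + 8 * C * (D * ε)) := by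
  have hε0 : 0 < ε := hε ▸ by positivity
  have hu : 0 < D * h := by positivity
  have hdom := heatDominated_riemannKernel (D := D) hh.le hW hc (fun i => x (i * h))
  have e1 : Real.exp (c * h) ^ (m + 1) = Real.exp (c * ε) := by
    rw [← Real.exp_nat_mul, ← hε]; congr 1; push_cast; ring
  have e2 : ((m : ℝ) + 1) * (D * h) = D * ε := by rw [← hε]; ring
  rw [iterKernel_block hu hdom]
  refine abs_iterKernel_sub_iterKernel_frozenKernel_le hD hε0 hT hW hc hη hC
    (fun i => (HeatDominated.iter hu (fun j => hdom _) m).congr_const e1 e2) (fun i _ b a => ?_) b a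
  have key := abs_iterKernel_sub_frozen_le (u := D * h) (h := h) (c := c) (η := η) (C := C)
    (v := D * ε) (w₀ := W (a - x (i * ε))) (a := a)
    (w := fun j b => W (b - x ((i * (m + 1) + j + 1 : ℕ) * h))) hu hh.le
    (fun j => hW.measurable.comp (measurable_id.sub_const _)) (fun _ _ => hc _) (hc _) hη hC m e2.le
    (fun j hj b => hmod _ _ _ _ ?_) b
  · rw [e1, e2, hε, ← two_mul] at key
    have g1 := heatKernel_nonneg (D * ε) (b - a)
    have g2 := heatKernel_nonneg (2 * (D * ε)) (b - a)
    have h2 : 0 ≤ 8 * C * (D * ε) := by positivity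
    refine key.trans ?_
    calc Real.exp (c * ε) * ε * (η * heatKernel (D * ε) (b - a) +
          8 * C * (D * ε) * heatKernel (2 * (D * ε)) (b - a))
        ≤ Real.exp (c * ε) * ε * ((η + 8 * C * (D * ε)) *
          (heatKernel (D * ε) (b - a) + heatKernel (2 * (D * ε)) (b - a))) := by
          refine mul_le_mul_of_nonneg_left ?_ (by positivity)
          nlinarith [mul_nonneg h2 g1, mul_nonneg hη g2]
      _ = _ := by ring
  · have e3 : ((i * (m + 1) + j + 1 : ℕ) : ℝ) * h - i * ε = (j + 1) * h := by
      rw [← hε]; push_cast; ring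
    rw [e3, abs_of_nonneg (by positivity)]
    refine le_trans ?_ hεδ
    rw [← hε]
    gcongr

end Frozen

/-- The time-sliced kernel with `n + 1` steps. -/
noncomputable def slicedKernel (D T : ℝ) (V x : ℝ → ℝ) (n : ℕ) : ℝ → ℝ → ℝ :=
  iterKernel (riemannKernel D V (T / (n + 1 : ℕ)) (fun i => x (i * (T / (n + 1 : ℕ))))) n

/-- The kernel obtained from the polygonal paths with `n + 1` edges. -/
noncomputable def slicedPolygonKernel (D T : ℝ) (V x : ℝ → ℝ) (n : ℕ) : ℝ → ℝ → ℝ :=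
  iterKernel (polygonKernel D V x (T / (n + 1 : ℕ))) n

section Limit

variable {D T c X : ℝ} {V x : ℝ → ℝ}

lemma add_one_mul_div (T : ℝ) (n : ℕ) : ((n : ℝ) + 1) * (T / (n + 1 : ℕ)) = T := by
  push_cast; field_simp

lemma exp_mul_div_pow (c T : ℝ) (n : ℕ) :
    Real.exp (c * (T / (n + 1 : ℕ))) ^ (n + 1) = Real.exp (c * T) := by
  rw [← Real.exp_nat_mul]; congr 1; push_cast; field_simp

lemma add_one_mul_mul_div (D T : ℝ) (n : ℕ) : ((n : ℝ) + 1) * (D * (T / (n + 1 : ℕ))) = D * T := by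
  push_cast; field_simp

lemma heatDominated_slicedKernel (hD : 0 < D) (hT : 0 < T) (hV : Continuous V)
    (hc : ∀ q, -c ≤ V q) (n : ℕ) :
    HeatDominated (Real.exp (c * T)) (D * T) (slicedKernel D T V x n) :=
  (HeatDominated.iter (by positivity) (heatDominated_riemannKernel (by positivity) hV hc _)
    n).congr_const (exp_mul_div_pow c T n) (add_one_mul_mul_div D T n)

/-- For a potential with a quadratic modulus of continuity the time-sliced kernels form a Cauchy
sequence along divisibility and have the same limit as the polygonal ones, uniformly. -/
lemma eventually_sliced_close_of_modulus (hD : 0 < D) (hT : 0 < T) {W : ℝ → ℝ} {L : ℝ}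
    (hW : UniformContinuous W) (hL : ∀ q, |W q| ≤ L) (hc : ∀ q, -c ≤ W q)
    (hx : UniformContinuous x) {τ : ℝ} (hτ : 0 < τ) :
    ∀ᶠ n : ℕ in atTop, (∀ m b a,
        |slicedKernel D T W x (n * (m + 1) + m) b a - slicedKernel D T W x n b a| ≤ τ) ∧
      ∀ b a, |slicedPolygonKernel D T W x n b a - slicedKernel D T W x n b a| ≤ τ := by
  set A := Real.exp (c * T) * T * (2 * (√(2 * Real.pi * (D * T)))⁻¹) with hA
  have hA0 : 0 < A := by positivity
  obtain ⟨C, δ, hC, hδ, hmod⟩ :=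
    exists_quadratic_modulus (η := τ / (4 * A)) hW hL hx (by positivity)
  have hε : Tendsto (fun n : ℕ => T / (n + 1 : ℕ)) atTop (𝓝 0) :=
    (tendsto_const_div_atTop_nhds_zero_nat T).comp (tendsto_add_atTop_nat 1)
  have hlim : Tendsto (fun n : ℕ => A * (τ / (4 * A) + 8 * C * (D * (T / (n + 1 : ℕ))))) atTop
      (𝓝 (A * (τ / (4 * A) + 8 * C * (D * 0)))) :=
    (((hε.const_mul D).const_mul (8 * C)).const_add _).const_mul A
  have hval : A * (τ / (4 * A) + 8 * C * (D * 0)) < τ / 2 := by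
    rw [mul_zero, mul_zero, add_zero]
    have : A * (τ / (4 * A)) = τ / 4 := by field_simp
    linarith
  filter_upwards [hε.eventually_le_const hδ, hlim.eventually_lt_const hval] with n hn1 hn2
  have hstep : 0 < T / (n + 1 : ℕ) := by positivity
  -- Both claims follow by comparison with the kernel with frozen potential.
  have hR : ∀ m b a, |slicedKernel D T W x (n * (m + 1) + m) b a -
      iterKernel (frozenKernel D W x (T / (n + 1 : ℕ))) n b a| ≤ τ / 2 := fun m b a => by
    refine (abs_iterKernel_riemannKernel_sub_le (h := T / (n * (m + 1) + m + 1 : ℕ)) hD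
      (by positivity) ?_ (add_one_mul_div T n) hW.continuous hc (by positivity) hC hmod hn1
      b a).trans hn2.le
    push_cast
    field_simp
    ring
  have hR0 : ∀ b a, |slicedKernel D T W x n b a -
      iterKernel (frozenKernel D W x (T / (n + 1 : ℕ))) n b a| ≤ τ / 2 := by
    simpa using hR 0
  refine ⟨fun m b a => ?_, fun b a => ?_⟩
  · refine (abs_sub_le _ (iterKernel (frozenKernel D W x (T / (n + 1 : ℕ))) n b a) _).trans ?_
    rw [abs_sub_comm _ (slicedKernel D T W x n b a)]
    linarith [hR m b a, hR0 b a]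
  · refine (abs_sub_le _ (iterKernel (frozenKernel D W x (T / (n + 1 : ℕ))) n b a) _).trans ?_
    rw [abs_sub_comm _ (slicedKernel D T W x n b a)]
    have := (abs_iterKernel_polygonKernel_sub_le hD hstep (add_one_mul_div T n) hW.continuous
      hx.continuous hc (by positivity) hC hmod hn1 b a).trans hn2.le
    have h' : |slicedPolygonKernel D T W x n b a -
      iterKernel (frozenKernel D W x (T / (n + 1 : ℕ))) n b a| ≤ τ / 2 := this
    linarith [hR0 b a]

lemma abs_segment_le {R a b s : ℝ} (ha : |a| ≤ R) (hb : |b| ≤ R) (h0 : 0 ≤ s) (h1 : s ≤ 1) :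
    |a + s * (b - a)| ≤ R := by
  obtain ⟨a1, a2⟩ := abs_le.1 ha
  obtain ⟨b1, b2⟩ := abs_le.1 hb
  exact abs_le.2 ⟨by nlinarith, by nlinarith⟩

/-- By the reflection principle the potential may be modified far away, so that the general case
follows from that of a bounded uniformly continuous potential. -/
lemma eventually_sliced_close (hD : 0 < D) (hT : 0 < T) (hV : Continuous V)
    (hc : ∀ q, -c ≤ V q) (hx : UniformContinuous x) (hX : ∀ t, |x t| ≤ X) (b a : ℝ) {τ : ℝ}
    (hτ : 0 < τ) :
    ∀ᶠ n : ℕ in atTop,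
      (∀ m, |slicedKernel D T V x (n * (m + 1) + m) b a - slicedKernel D T V x n b a| ≤ τ) ∧
      |slicedPolygonKernel D T V x n b a - slicedKernel D T V x n b a| ≤ τ := by
  have hDT : 0 < D * T := by positivity
  have hlim := (tendsto_mirrorKernel hDT b a).const_mul (Real.exp (c * T))
  rw [mul_zero] at hlim
  obtain ⟨R, hRm, hRb, hRa⟩ := ((hlim.eventually_lt_const (show 0 < τ / 4 by positivity)).and
    ((eventually_ge_atTop |b|).and (eventually_ge_atTop |a|))).exists
  have hX0 : 0 ≤ X := (abs_nonneg _).trans (hX 0)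
  have hR0 : 0 ≤ R := (abs_nonneg _).trans hRb
  have hS : -(R + X) ≤ R + X := by linarith
  -- `W` agrees with `V` on `[-(R + X), R + X]`, where `q - x t` lies as long as `|q| ≤ R`, and is
  -- constant on either side of that interval.
  set f : Set.Icc (-(R + X)) (R + X) → ℝ := fun y => V y with hf
  have hfc : Continuous f := hV.comp continuous_subtype_val
  set W := Set.IccExtend hS f with hW
  have hWV : ∀ q t, |q| ≤ R → W (q - x t) = V (q - x t) := fun q t hq => by
    have h1 : |q - x t| ≤ R + X := (abs_sub _ _).trans (add_le_add hq (hX t))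
    exact Set.IccExtend_of_mem hS f (abs_le.1 h1)
  have hWc : ∀ q, -c ≤ W q := fun q => hc _
  have hWu := uniformContinuous_IccExtend hS hfc
  obtain ⟨L, hL⟩ := exists_abs_IccExtend_le hS hfc
  have hriem : ∀ n, |slicedKernel D T V x n b a - slicedKernel D T W x n b a| ≤ τ / 4 := fun n => by
    have h := abs_iterKernel_sub_le_mirrorKernel (R := R) (v := D * (T / (n + 1 : ℕ)))
      (by positivity) (Real.exp_nonneg _)
      (heatDominated_riemannKernel (D := D) (ε := T / (n + 1 : ℕ)) (by positivity) hV hc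
        (fun i => x (i * (T / (n + 1 : ℕ)))))
      (heatDominated_riemannKernel (D := D) (by positivity) hWu.continuous hWc
        (fun i => x (i * (T / (n + 1 : ℕ)))))
      (fun i b a hb ha => by simp only [riemannKernel]; rw [← hWV _ _ hb]) n hRb hRa
    rw [exp_mul_div_pow, add_one_mul_mul_div] at h
    exact h.trans hRm.le
  have hpoly : ∀ n, |slicedPolygonKernel D T V x n b a - slicedPolygonKernel D T W x n b a| ≤
      τ / 4 := fun n => by
    have h := abs_iterKernel_sub_le_mirrorKernel (R := R) (v := D * (T / (n + 1 : ℕ)))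
      (by positivity) (Real.exp_nonneg _)
      (heatDominated_polygonKernel (D := D) (ε := T / (n + 1 : ℕ)) (by positivity) hV
        hx.continuous hc)
      (heatDominated_polygonKernel (D := D) (by positivity) hWu.continuous hx.continuous hWc)
      (fun i b a hb ha => by
        simp only [polygonKernel]
        congr 4
        refine intervalIntegral.integral_congr fun s hs => ?_
        rw [Set.uIcc_of_le zero_le_one] at hs
        exact (hWV _ _ (abs_segment_le ha hb hs.1 hs.2)).symm) n hRb hRa
    rw [exp_mul_div_pow, add_one_mul_mul_div] at h
    exact h.trans hRm.le
  filter_upwards [eventually_sliced_close_of_modulus hD hT hWu hL hWc hx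
    (show 0 < τ / 2 by positivity)] with n hn
  refine ⟨fun m => ?_, ?_⟩
  · have h1 := abs_le.1 (hriem (n * (m + 1) + m))
    have h2 := abs_le.1 (hriem n)
    have h3 := abs_le.1 (hn.1 m b a)
    exact abs_le.2 ⟨by linarith, by linarith⟩
  · have h1 := abs_le.1 (hpoly n)
    have h2 := abs_le.1 (hriem n)
    have h3 := abs_le.1 (hn.2 b a)
    exact abs_le.2 ⟨by linarith, by linarith⟩

lemma exists_tendsto_slicedKernel (hD : 0 < D) (hT : 0 < T) (hV : Continuous V)
    (hc : ∀ q, -c ≤ V q) (hx : UniformContinuous x) (hX : ∀ t, |x t| ≤ X) (b a : ℝ) :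
    ∃ K, Tendsto (fun n => slicedKernel D T V x n b a) atTop (𝓝 K) := by
  refine cauchySeq_tendsto_of_complete (Metric.cauchySeq_iff.2 fun τ hτ => ?_)
  obtain ⟨n₀, hn₀⟩ := eventually_atTop.1
    (eventually_sliced_close hD hT hV hc hx hX b a (show 0 < τ / 3 by positivity))
  refine ⟨n₀, fun n hn m hm => ?_⟩
  -- Both kernels are compared with the one on the common refinement of the two subdivisions.
  have h1 := abs_le.1 ((hn₀ n hn).1 m)
  have h2 := abs_le.1 ((hn₀ m hm).1 n)
  have e : m * (n + 1) + n = n * (m + 1) + m := by ring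
  rw [e] at h2
  rw [Real.dist_eq]
  exact abs_lt.2 ⟨by linarith, by linarith⟩

lemma tendsto_slicedPolygonKernel (hD : 0 < D) (hT : 0 < T) (hV : Continuous V)
    (hc : ∀ q, -c ≤ V q) (hx : UniformContinuous x) (hX : ∀ t, |x t| ≤ X) {b a K : ℝ}
    (hK : Tendsto (fun n => slicedKernel D T V x n b a) atTop (𝓝 K)) :
    Tendsto (fun n => slicedPolygonKernel D T V x n b a) atTop (𝓝 K) := by
  have h : Tendsto (fun n => slicedPolygonKernel D T V x n b a - slicedKernel D T V x n b a) atTop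
      (𝓝 0) := by
    refine Metric.tendsto_nhds.2 fun τ hτ => ?_
    filter_upwards [eventually_sliced_close hD hT hV hc hx hX b a (show 0 < τ / 2 by positivity)]
      with n hn
    rw [Real.dist_eq, sub_zero]
    linarith [hn.2]
  simpa using h.add hK

/-- Paths that stay in a compact interval contribute a definite positive amount. -/
lemma pos_of_tendsto_slicedKernel (hD : 0 < D) (hT : 0 < T) (hV : Continuous V)
    (hc : ∀ q, -c ≤ V q) (hX : ∀ t, |x t| ≤ X) {b a K : ℝ}
    (hK : Tendsto (fun n => slicedKernel D T V x n b a) atTop (𝓝 K)) : 0 < K := by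
  have hDT : 0 < D * T := by positivity
  obtain ⟨R, hRm, hRb, hRa⟩ := (((tendsto_mirrorKernel hDT b a).eventually_lt_const
    (heatKernel_pos hDT (b - a))).and
    ((eventually_ge_atTop |b|).and (eventually_ge_atTop |a|))).exists
  obtain ⟨lam, hlam⟩ := (isCompact_Icc (a := -(R + X)) (b := R + X)).bddAbove_image hV.continuousOn
  have hle : ∀ q t, |q| ≤ R → V (q - x t) ≤ lam := fun q t hq =>
    hlam ⟨_, abs_le.1 ((abs_sub _ _).trans (add_le_add hq (hX t))), rfl⟩
  have hlow : ∀ n, Real.exp (-lam * T) * (heatKernel (D * T) (b - a) - mirrorKernel R (D * T) b a) ≤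
      slicedKernel D T V x n b a := fun n => by
    have hε : 0 < T / (n + 1 : ℕ) := by positivity
    have hdom := (heatDominated_heatKernel (D * (T / (n + 1 : ℕ))))
    have h := iterKernel_sub_le_mirrorKernel (R := R) (v := D * (T / (n + 1 : ℕ)))
      (E' := Real.exp (-lam * (T / (n + 1 : ℕ))))
      (k' := fun _ b a => Real.exp (-lam * (T / (n + 1 : ℕ))) *
        heatKernel (D * (T / (n + 1 : ℕ))) (b - a)) (by positivity) (Real.exp_nonneg _)
      (heatDominated_riemannKernel (D := D) (ε := T / (n + 1 : ℕ)) (by positivity) hV hc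
        (fun i => x (i * (T / (n + 1 : ℕ)))))
      (fun _ => ⟨hdom.measurable.const_mul _,
        fun _ _ => mul_nonneg (Real.exp_nonneg _) (heatKernel_nonneg _ _), fun _ _ => le_rfl⟩)
      (fun i b a hb _ => by
        rw [mul_comm]
        refine mul_le_mul_of_nonneg_left (Real.exp_le_exp.2 ?_) (heatKernel_nonneg _ _)
        nlinarith [hle b ((i + 1 : ℕ) * (T / (n + 1 : ℕ))) hb]) n hRb hRa
    rw [iterKernel_const_mul, iterKernel_heatKernel (by positivity), exp_mul_div_pow,
      add_one_mul_mul_div] at h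
    rw [mul_sub]
    exact (sub_le_comm.1 h)
  refine lt_of_lt_of_le ?_ (ge_of_tendsto' hK hlow)
  exact mul_pos (Real.exp_pos _) (sub_pos.2 hRm)

end Limit

/-! ### Actions as products of one-step kernels -/

lemma prod_Icc_one_eq_prod_range {α : Type*} [CommMonoid α] (f : ℕ → α) (n : ℕ) :
    ∏ i ∈ Finset.Icc 1 n, f i = ∏ i ∈ Finset.range n, f (i + 1) := by
  induction n with
  | zero => simp
  | succ n ih => rw [Finset.prod_Icc_succ_top (by omega), ih, Finset.prod_range_succ]

lemma sum_Icc_one_eq_sum_range (f : ℕ → ℝ) (n : ℕ) :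
    ∑ i ∈ Finset.Icc 1 n, f i = ∑ i ∈ Finset.range n, f (i + 1) := by
  induction n with
  | zero => simp
  | succ n ih => rw [Finset.sum_Icc_succ_top (by omega), ih, Finset.sum_range_succ]

lemma heatKernel_mul_eq {D ε : ℝ} (hD : 0 < D) (hε : 0 < ε) (d : ℝ) :
    heatKernel (D * ε) d =
      1 / √(2 * Real.pi * D * ε) * Real.exp (-(ε * ((d / ε) ^ 2 / (2 * D)))) := by
  unfold heatKernel
  rw [one_div, mul_assoc (2 * Real.pi)]
  congr 2
  field_simp

lemma wienerPrefactor_mul_exp_discreteAction {D ε : ℝ} (hD : 0 < D) (hε : 0 < ε) (V : ℝ → ℝ)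
    (xs : ℕ → ℝ) (n : ℕ) (z : ℕ → ℝ) :
    wienerPrefactor D ε n * Real.exp (-discreteAction D V ε xs n z) =
      ∏ i ∈ Finset.range n, riemannKernel D V ε xs i (z (i + 1)) (z i) := by
  simp only [wienerPrefactor, discreteAction, sum_Icc_one_eq_sum_range, riemannKernel,
    Nat.add_sub_cancel, heatKernel_mul_eq hD hε, mul_assoc, ← Real.exp_add]
  rw [Finset.prod_mul_distrib, Finset.prod_const, Finset.card_range, ← Real.exp_sum,
    Finset.mul_sum, ← Finset.sum_neg_distrib]
  congr 2
  refine Finset.sum_congr rfl fun i _ => ?_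
  ring

lemma polygonalPath_eq {ε : ℝ} (hε : 0 < ε) (z : ℕ → ℝ) (i : ℕ) {t : ℝ}
    (ht : t ∈ Set.Ioo (i * ε) ((i + 1) * ε)) :
    polygonalPath ε z t = z i + (t / ε - i) * (z (i + 1) - z i) := by
  have h : ⌊t / ε⌋₊ = i := by
    rw [Nat.floor_eq_iff (div_nonneg ((by positivity : (0 : ℝ) ≤ i * ε).trans ht.1.le) hε.le)]
    exact ⟨(le_div_iff₀ hε).2 ht.1.le, (div_lt_iff₀ hε).2 ht.2⟩
  simp only [polygonalPath, h]

lemma deriv_polygonalPath {ε : ℝ} (hε : 0 < ε) (z : ℕ → ℝ) (i : ℕ) {t : ℝ}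
    (ht : t ∈ Set.Ioo (i * ε) ((i + 1) * ε)) :
    deriv (polygonalPath ε z) t = (z (i + 1) - z i) / ε := by
  have h : polygonalPath ε z =ᶠ[𝓝 t] fun t => z i + (t / ε - i) * (z (i + 1) - z i) := by
    filter_upwards [isOpen_Ioo.mem_nhds ht] with s hs using polygonalPath_eq hε z i hs
  rw [h.deriv_eq]
  have hd : HasDerivAt (fun t : ℝ => z i + (t / ε - i) * (z (i + 1) - z i))
      (1 / ε * (z (i + 1) - z i)) t :=
    ((((hasDerivAt_id t).div_const ε).sub_const _).mul_const _).const_add _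
  rw [hd.deriv]
  ring

lemma onsagerMachlupAction_polygonalPath {D T ε : ℝ} {V x : ℝ → ℝ} {n : ℕ} (hε : 0 < ε)
    (hT : n * ε = T) (hV : Continuous V) (hx : Continuous x) (z : ℕ → ℝ) :
    onsagerMachlupAction D V x T (polygonalPath ε z) =
      ∑ i ∈ Finset.range n, (ε * (((z (i + 1) - z i) / ε) ^ 2 / (2 * D)) +
        ε * ∫ s in (0 : ℝ)..1, V (z i + s * (z (i + 1) - z i) - x (ε * (i + s)))) := by
  set g : ℕ → ℝ → ℝ := fun i t => ((z (i + 1) - z i) / ε) ^ 2 / (2 * D) +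
    V (z i + (t / ε - i) * (z (i + 1) - z i) - x t) with hg
  have hgc : ∀ i, Continuous (g i) := fun i => by simp only [hg]; fun_prop
  set f : ℝ → ℝ := fun t => (deriv (polygonalPath ε z) t) ^ 2 / (2 * D) +
    V (polygonalPath ε z t - x t) with hf
  have hle : ∀ i : ℕ, (i : ℝ) * ε ≤ ((i + 1 : ℕ) : ℝ) * ε := fun i => by
    gcongr; exact i.le_succ
  have hfg : ∀ i : ℕ, Set.EqOn f (g i) (Set.Ioo (i * ε) ((i + 1 : ℕ) * ε)) := fun i t ht => by
    push_cast at ht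
    simp only [hf, hg, deriv_polygonalPath hε z i ht, polygonalPath_eq hε z i ht]
  have hint : ∀ i < n, IntervalIntegrable f volume (i * ε) ((i + 1 : ℕ) * ε) := fun i _ => by
    refine ((hgc i).intervalIntegrable _ _).congr_uIoo ?_
    rw [Set.uIoo_of_le (hle i)]
    exact (hfg i).symm
  have hsum := intervalIntegral.sum_integral_adjacent_intervals (a := fun i : ℕ => (i : ℝ) * ε) hint
  simp only [Nat.cast_zero, zero_mul, hT] at hsum
  rw [onsagerMachlupAction, ← hsum]
  refine Finset.sum_congr rfl fun i _ => ?_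
  rw [intervalIntegral.integral_congr_Ioo_of_le (hle i) (hfg i)]
  have hsub := intervalIntegral.smul_integral_comp_mul_add (a := 0) (b := 1) (g i) ε (ε * i)
  have e1 : ε * 0 + ε * i = i * ε := by ring
  have e2 : ε * 1 + ε * i = (i + 1 : ℕ) * ε := by push_cast; ring
  rw [e1, e2] at hsub
  have hgs : ∀ s, g i (ε * s + ε * i) = ((z (i + 1) - z i) / ε) ^ 2 / (2 * D) +
      V (z i + s * (z (i + 1) - z i) - x (ε * (i + s))) := fun s => by
    have h1 : ε * s + ε * i = ε * (i + s) := by ring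
    have h2 : ε * (i + s) / ε - i = s := by field_simp; ring
    simp only [hg, h1, h2]
  rw [← hsub]
  simp only [hgs]
  rw [intervalIntegral.integral_add intervalIntegrable_const
    (intervalIntegrable_segment hV hx ε i _ _)]
  simp [mul_add]

lemma wienerPrefactor_mul_exp_onsagerMachlupAction {D T ε : ℝ} {V x : ℝ → ℝ} {n : ℕ} (hD : 0 < D)
    (hε : 0 < ε) (hT : n * ε = T) (hV : Continuous V) (hx : Continuous x) (z : ℕ → ℝ) :
    wienerPrefactor D ε n * Real.exp (-onsagerMachlupAction D V x T (polygonalPath ε z)) =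
      ∏ i ∈ Finset.range n, polygonKernel D V x ε i (z (i + 1)) (z i) := by
  rw [onsagerMachlupAction_polygonalPath hε hT hV hx]
  simp only [wienerPrefactor, polygonKernel, heatKernel_mul_eq hD hε, mul_assoc, ← Real.exp_add]
  rw [Finset.prod_mul_distrib, Finset.prod_const, Finset.card_range, ← Real.exp_sum,
    ← Finset.sum_neg_distrib]
  congr 2
  refine Finset.sum_congr rfl fun i _ => ?_
  ring

lemma wienerPrefactor_pos {D ε : ℝ} (hD : 0 < D) (hε : 0 < ε) (n : ℕ) :
    0 < wienerPrefactor D ε n := by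
  have := Real.pi_pos
  unfold wienerPrefactor
  positivity

lemma integral_exp_discreteAction {D ε c : ℝ} {V : ℝ → ℝ} (hD : 0 < D) (hε : 0 < ε)
    (hV : Continuous V) (hc : ∀ q, -c ≤ V q) (xs : ℕ → ℝ) (n : ℕ) (b a : ℝ) :
    Integrable (fun y : Fin n → ℝ =>
      Real.exp (-discreteAction D V ε xs (n + 1) (chain (n + 1) a b y))) ∧
    wienerPrefactor D ε (n + 1) * ∫ y : Fin n → ℝ,
      Real.exp (-discreteAction D V ε xs (n + 1) (chain (n + 1) a b y)) =
        iterKernel (riemannKernel D V ε xs) n b a := by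
  have h := integral_chain_eq_iterKernel (v := D * ε) (by positivity)
    (heatDominated_riemannKernel (D := D) hε.le hV hc xs) n b a
  simp only [← wienerPrefactor_mul_exp_discreteAction hD hε, integral_const_mul] at h
  exact ⟨(integrable_const_mul_iff (wienerPrefactor_pos hD hε _).ne'.isUnit _).1 h.1, h.2⟩

lemma slicedPathIntegral_wienerPrefactor {D T c : ℝ} {V x : ℝ → ℝ} (hD : 0 < D) (hT : 0 < T)
    (hV : Continuous V) (hx : Continuous x) (hc : ∀ q, -c ≤ V q) (n : ℕ) (b a : ℝ) :
    slicedPathIntegral (wienerPrefactor D (T / (n + 1 : ℕ)) (n + 1)) T (n + 1) b a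
      (fun γ => Real.exp (-onsagerMachlupAction D V x T γ)) =
        slicedPolygonKernel D T V x n b a := by
  have hε : 0 < T / (n + 1 : ℕ) := by positivity
  have h := integral_chain_eq_iterKernel (v := D * (T / (n + 1 : ℕ))) (by positivity)
    (heatDominated_polygonKernel (D := D) hε.le hV hx hc) n b a
  have hT' : ((n + 1 : ℕ) : ℝ) * (T / (n + 1 : ℕ)) = T := by field_simp
  simp only [← wienerPrefactor_mul_exp_onsagerMachlupAction hD hε hT' hV hx,
    integral_const_mul] at h
  exact h.2

/-! ### Bayesian updates -/

lemma HeatDominated.integrable_mul_density {E v : ℝ} {k : ℝ → ℝ → ℝ} {p : ℝ → ℝ} (hv : 0 < v)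
    (hk : HeatDominated E v k) (hp : Integrable p) (b : ℝ) : Integrable (fun a => k b a * p a) := by
  refine hp.bdd_mul (c := |E| * (√(2 * Real.pi * v))⁻¹)
    (hk.measurable_right b).aestronglyMeasurable (Eventually.of_forall fun a => ?_)
  rw [Real.norm_of_nonneg (hk.nonneg _ _)]
  refine (hk.le b a).trans ?_
  exact mul_le_mul (le_abs_self E) (heatKernel_le hv _) (heatKernel_nonneg _ _) (abs_nonneg _)

lemma integrable_prod_heatKernel_mul_density {v : ℝ} {p : ℝ → ℝ} (hv : 0 < v)
    (hp : Integrable p) : Integrable (fun z : ℝ × ℝ => heatKernel v (z.1 - z.2) * p z.2) := by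
  have hmeas : AEStronglyMeasurable (fun z : ℝ × ℝ => heatKernel v (z.1 - z.2) * p z.2)
      (volume.prod volume) :=
    ((measurable_heatKernel v).comp (measurable_fst.sub measurable_snd)).aestronglyMeasurable.mul
      hp.aestronglyMeasurable.comp_snd
  refine (integrable_prod_iff' hmeas).2
    ⟨Eventually.of_forall fun a => (integrable_heatKernel_sub hv a).mul_const (p a), ?_⟩
  simp only [norm_mul, Real.norm_of_nonneg (heatKernel_nonneg _ _), integral_mul_const,
    integral_heatKernel_sub hv, one_mul]
  exact hp.norm

lemma HeatDominated.integrable_prod_mul_density {E v : ℝ} {k : ℝ → ℝ → ℝ} {p : ℝ → ℝ}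
    (hv : 0 < v) (hk : HeatDominated E v k) (hp : Integrable p) :
    Integrable (fun z : ℝ × ℝ => k z.1 z.2 * p z.2) := by
  refine ((integrable_prod_heatKernel_mul_density hv hp).norm.const_mul E).mono'
    (hk.measurable.aestronglyMeasurable.mul hp.aestronglyMeasurable.comp_snd)
    (Eventually.of_forall fun z => ?_)
  rw [norm_mul, norm_mul, Real.norm_of_nonneg (hk.nonneg _ _),
    Real.norm_of_nonneg (heatKernel_nonneg _ _), ← mul_assoc]
  exact mul_le_mul_of_nonneg_right (hk.le _ _) (norm_nonneg _)

lemma integral_mul_density_pos {k p : ℝ → ℝ} (hp : IsProbDensity p) (hk : ∀ a, 0 < k a)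
    (hint : Integrable (fun a => k a * p a)) : 0 < ∫ a, k a * p a := by
  rw [integral_pos_iff_support_of_nonneg (fun a => mul_nonneg (hk a).le (hp.1 a)) hint]
  have h : Function.support (fun a => k a * p a) = Function.support p := by
    ext a; simp [(hk a).ne']
  rw [h, ← integral_pos_iff_support_of_nonneg hp.1 hp.2.1, hp.2.2]
  exact one_pos

lemma integral_pos_of_pos {f : ℝ → ℝ} (hf : ∀ q, 0 < f q) (hint : Integrable f) :
    0 < ∫ q, f q := by
  rw [integral_pos_iff_support_of_nonneg (fun q => (hf q).le) hint,
    show Function.support f = Set.univ from Set.eq_univ_of_forall fun q => (hf q).ne']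
  simp

section Bayes

variable {M D ε c : ℝ} {V : ℝ → ℝ} {p : ℝ → ℝ}

lemma predictiveDensity_eq (hD : 0 < D) (hε : 0 < ε) (p : ℝ → ℝ) (q : ℝ) :
    predictiveDensity D ε p q = ∫ q', heatKernel (D * ε) (q - q') * p q' := by
  simp only [predictiveDensity, wienerTransition_eq hD hε]

lemma predictiveDensity_pos (hD : 0 < D) (hε : 0 < ε) (hp : IsProbDensity p) (q : ℝ) :
    0 < predictiveDensity D ε p q := by
  have hv : 0 < D * ε := by positivity
  rw [predictiveDensity_eq hD hε]
  exact integral_mul_density_pos hp (fun a => heatKernel_pos hv _)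
    ((heatDominated_heatKernel _).integrable_mul_density hv hp.2.1 q)

lemma expLikelihood_pos (hM : 0 < M) (x q : ℝ) : 0 < expLikelihood M V ε x q :=
  mul_pos hM (Real.exp_pos _)

lemma integrable_expLikelihood_mul (hM : 0 < M) (hD : 0 < D) (hε : 0 < ε) (hV : Continuous V)
    (hc : ∀ q, -c ≤ V q) (hp : IsProbDensity p) (x : ℝ) :
    Integrable (fun q => expLikelihood M V ε x q * predictiveDensity D ε p q) := by
  have h : Integrable (predictiveDensity D ε p) := by
    refine (integrable_prod_heatKernel_mul_density (v := D * ε) (by positivity)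
      hp.2.1).integral_prod_left.congr (Eventually.of_forall fun q => ?_)
    exact (predictiveDensity_eq hD hε p q).symm
  refine h.bdd_mul (c := M * Real.exp (c * ε)) ?_ (Eventually.of_forall fun q => ?_)
  · exact Continuous.aestronglyMeasurable (by unfold expLikelihood; fun_prop)
  · rw [Real.norm_of_nonneg (expLikelihood_pos hM _ _).le]
    refine mul_le_mul_of_nonneg_left (Real.exp_le_exp.2 ?_) hM.le
    nlinarith [hc (q - x)]

lemma evidence_pos (hM : 0 < M) (hD : 0 < D) (hε : 0 < ε) (hV : Continuous V)
    (hc : ∀ q, -c ≤ V q) (hp : IsProbDensity p) (x : ℝ) : 0 < evidence M V D ε x p :=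
  integral_pos_of_pos
    (fun q => mul_pos (expLikelihood_pos hM _ _) (predictiveDensity_pos hD hε hp q))
    (integrable_expLikelihood_mul hM hD hε hV hc hp x)

lemma isProbDensity_bayesUpdate (hM : 0 < M) (hD : 0 < D) (hε : 0 < ε) (hV : Continuous V)
    (hc : ∀ q, -c ≤ V q) (hp : IsProbDensity p) (x : ℝ) :
    IsProbDensity (bayesUpdate M V D ε x p) := by
  have hZ := evidence_pos hM hD hε hV hc hp x
  have hint := integrable_expLikelihood_mul hM hD hε hV hc hp x
  have e : bayesUpdate M V D ε x p = fun q => (evidence M V D ε x p)⁻¹ *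
      (expLikelihood M V ε x q * predictiveDensity D ε p q) := by
    funext q; simp only [bayesUpdate]; ring
  rw [e]
  refine ⟨fun q => ?_, hint.const_mul _, ?_⟩
  · exact mul_nonneg (inv_nonneg.2 hZ.le)
      (mul_nonneg (expLikelihood_pos hM _ _).le (predictiveDensity_pos hD hε hp q).le)
  · rw [integral_const_mul]
    exact inv_mul_cancel₀ hZ.ne'

lemma isProbDensity_posterior (hM : 0 < M) (hD : 0 < D) (hε : 0 < ε) (hV : Continuous V)
    (hc : ∀ q, -c ≤ V q) (hp : IsProbDensity p) (xs : ℕ → ℝ) (n : ℕ) :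
    IsProbDensity (posterior M V D ε xs p n) := by
  induction n with
  | zero => exact hp
  | succ n ih => exact isProbDensity_bayesUpdate hM hD hε hV hc ih _

lemma stepEvidence_pos (hM : 0 < M) (hD : 0 < D) (hε : 0 < ε) (hV : Continuous V)
    (hc : ∀ q, -c ≤ V q) (hp : IsProbDensity p) (xs : ℕ → ℝ) (i : ℕ) :
    0 < stepEvidence M V D ε xs p i :=
  evidence_pos hM hD hε hV hc (isProbDensity_posterior hM hD hε hV hc hp xs _) _

lemma posterior_succ_eq (hD : 0 < D) (hε : 0 < ε) (xs : ℕ → ℝ) (n : ℕ) (q : ℝ) :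
    posterior M V D ε xs p (n + 1) q = M / stepEvidence M V D ε xs p (n + 1) *
      ∫ q', riemannKernel D V ε xs n q q' * posterior M V D ε xs p n q' := by
  simp only [posterior, bayesUpdate, stepEvidence, Nat.add_sub_cancel, expLikelihood,
    predictiveDensity_eq hD hε, riemannKernel]
  rw [← integral_const_mul, ← integral_const_mul]
  refine integral_congr_ae (Eventually.of_forall fun q' => ?_)
  simp only [mul_comm (V (q - xs (n + 1))) ε]
  ring

/-- The posterior density in terms of the composed kernel. -/
lemma posterior_eq_integral_iterKernel (hD : 0 < D) (hε : 0 < ε) (hV : Continuous V)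
    (hc : ∀ q, -c ≤ V q) (hp : IsProbDensity p) (xs : ℕ → ℝ) (n : ℕ) (q : ℝ) :
    posterior M V D ε xs p (n + 1) q =
      (∏ i ∈ Finset.Icc 1 (n + 1), M / stepEvidence M V D ε xs p i) *
        ∫ q₀, iterKernel (riemannKernel D V ε xs) n q q₀ * p q₀ := by
  have hv : 0 < D * ε := by positivity
  have hk := heatDominated_riemannKernel (D := D) hε.le hV hc xs
  induction n generalizing q with
  | zero => rw [posterior_succ_eq hD hε]; simp [posterior, iterKernel]
  | succ n ih =>
    rw [posterior_succ_eq hD hε, Finset.prod_Icc_succ_top (by omega)]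
    simp only [ih]
    set C := ∏ i ∈ Finset.Icc 1 (n + 1), M / stepEvidence M V D ε xs p i
    have hi := HeatDominated.iter hv hk n
    have hw : 0 < ((n : ℝ) + 1) * (D * ε) := by positivity
    set B := Real.exp (c * ε) * (√(2 * Real.pi * (D * ε)))⁻¹
    -- The first factor is bounded, so that Fubini's theorem applies.
    have hdom : HeatDominated (B * Real.exp (c * ε) ^ (n + 1)) ((n + 1) * (D * ε))
        (fun q' q₀ => riemannKernel D V ε xs (n + 1) q q' *
          iterKernel (riemannKernel D V ε xs) n q' q₀) := by
      refine ⟨(((hk (n + 1)).measurable_right q).comp measurable_fst).mul hi.measurable,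
        fun _ _ => mul_nonneg ((hk _).nonneg _ _) (hi.nonneg _ _), fun q' q₀ => ?_⟩
      rw [mul_assoc]
      refine mul_le_mul (((hk _).le _ _).trans ?_) (hi.le _ _) (hi.nonneg _ _) (by positivity)
      exact mul_le_mul_of_nonneg_left (heatKernel_le hv _) (Real.exp_nonneg _)
    have hswap := integral_integral_swap (f := fun q' q₀ =>
      riemannKernel D V ε xs (n + 1) q q' * iterKernel (riemannKernel D V ε xs) n q' q₀ * p q₀)
      (hdom.integrable_prod_mul_density hw hp.2.1)
    have e : ∀ q', riemannKernel D V ε xs (n + 1) q q' *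
        (C * ∫ q₀, iterKernel (riemannKernel D V ε xs) n q' q₀ * p q₀) =
        C * ∫ q₀, riemannKernel D V ε xs (n + 1) q q' *
          iterKernel (riemannKernel D V ε xs) n q' q₀ * p q₀ := fun q' => by
      simp only [mul_assoc, integral_const_mul]
      ring
    simp only [e, integral_const_mul]
    rw [hswap]
    simp only [iterKernel, compKernel, integral_mul_const]
    ring

lemma bayesKernel_eq (hD : 0 < D) (hε : 0 < ε) (hV : Continuous V) (hc : ∀ q, -c ≤ V q)
    (xs : ℕ → ℝ) (n : ℕ) (b a : ℝ) :
    bayesKernel M V D ε xs p (n + 1) b a =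
      (∏ i ∈ Finset.Icc 1 (n + 1), M / stepEvidence M V D ε xs p i) *
        iterKernel (riemannKernel D V ε xs) n b a := by
  have h := (integral_chain_eq_iterKernel (v := D * ε) (by positivity)
    (heatDominated_riemannKernel (D := D) hε.le hV hc xs) n b a).2
  rw [← h, ← integral_const_mul]
  unfold bayesKernel
  refine integral_congr_ae (Eventually.of_forall fun y => ?_)
  simp only [prod_Icc_one_eq_prod_range, Nat.add_sub_cancel]
  rw [← Finset.prod_mul_distrib]
  refine Finset.prod_congr rfl fun i _ => ?_
  simp only [expLikelihood, riemannKernel, wienerTransition_eq hD hε]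
  rw [mul_comm (V _) ε]
  ring

lemma kernelPrefactor_eq (xs : ℕ → ℝ) (n : ℕ) :
    kernelPrefactor M V D ε xs p n =
      (∏ i ∈ Finset.Icc 1 n, M / stepEvidence M V D ε xs p i) * wienerPrefactor D ε n := by
  have h : wienerPrefactor D ε n = ∏ _i ∈ Finset.Icc 1 n, 1 / √(2 * Real.pi * D * ε) := by
    simp [wienerPrefactor]
  rw [h, ← Finset.prod_mul_distrib]
  refine Finset.prod_congr rfl fun i _ => ?_
  rw [div_mul_div_comm, mul_one]

/-- The product of the evidences is the total mass of the unnormalized posterior density. -/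
lemma prod_div_stepEvidence_eq (hM : 0 < M) (hD : 0 < D) (hε : 0 < ε) (hV : Continuous V)
    (hc : ∀ q, -c ≤ V q) (hp : IsProbDensity p) (xs : ℕ → ℝ) (n : ℕ) :
    ∏ i ∈ Finset.Icc 1 (n + 1), M / stepEvidence M V D ε xs p i =
      (∫ q, ∫ q₀, iterKernel (riemannKernel D V ε xs) n q q₀ * p q₀)⁻¹ := by
  have h := (isProbDensity_posterior hM hD hε hV hc hp xs (n + 1)).2.2
  simp only [posterior_eq_integral_iterKernel hD hε hV hc hp, integral_const_mul] at h
  exact eq_inv_of_mul_eq_one_left h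

end Bayes

/-! ### The continuum limit -/

section Continuum

variable {D T c X : ℝ} {V x : ℝ → ℝ} {K : ℝ → ℝ → ℝ} {p : ℝ → ℝ}

lemma heatDominated_of_tendsto (hD : 0 < D) (hT : 0 < T) (hV : Continuous V)
    (hc : ∀ q, -c ≤ V q)
    (hK : ∀ b a, Tendsto (fun n => slicedKernel D T V x n b a) atTop (𝓝 (K b a))) :
    HeatDominated (Real.exp (c * T)) (D * T) K where
  measurable := measurable_of_tendsto_metrizable
    (fun n => (heatDominated_slicedKernel (x := x) hD hT hV hc n).measurable)
    (tendsto_pi_nhds.2 fun z => hK z.1 z.2)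
  nonneg b a := ge_of_tendsto' (hK b a) fun n =>
    (heatDominated_slicedKernel hD hT hV hc n).nonneg b a
  le b a := le_of_tendsto' (hK b a) fun n => (heatDominated_slicedKernel hD hT hV hc n).le b a

/-- The evidence of all the data, up to the constants of the likelihood, converges. -/
lemma tendsto_integral_slicedKernel (hD : 0 < D) (hT : 0 < T) (hV : Continuous V)
    (hc : ∀ q, -c ≤ V q) (hp : IsProbDensity p)
    (hK : ∀ b a, Tendsto (fun n => slicedKernel D T V x n b a) atTop (𝓝 (K b a))) :
    Tendsto (fun n => ∫ q, ∫ q₀, slicedKernel D T V x n q q₀ * p q₀) atTop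
      (𝓝 (∫ q, ∫ q₀, K q q₀ * p q₀)) := by
  have hDT : 0 < D * T := by positivity
  have hdom := heatDominated_slicedKernel (x := x) hD hT hV hc
  have hint := fun n => (hdom n).integrable_prod_mul_density hDT hp.2.1
  have hKint := (heatDominated_of_tendsto hD hT hV hc hK).integrable_prod_mul_density hDT hp.2.1
  have e1 : ∀ n, ∫ q, ∫ q₀, slicedKernel D T V x n q q₀ * p q₀ =
      ∫ z : ℝ × ℝ, slicedKernel D T V x n z.1 z.2 * p z.2 := fun n =>
    (integral_prod _ (hint n)).symm
  have e2 : ∫ q, ∫ q₀, K q q₀ * p q₀ = ∫ z : ℝ × ℝ, K z.1 z.2 * p z.2 :=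
    (integral_prod _ hKint).symm
  simp only [e1, e2]
  refine tendsto_integral_of_dominated_convergence
    (fun z : ℝ × ℝ => Real.exp (c * T) * (heatKernel (D * T) (z.1 - z.2) * p z.2))
    (fun n => (hint n).aestronglyMeasurable)
    ((integrable_prod_heatKernel_mul_density hDT hp.2.1).const_mul _)
    (fun n => Eventually.of_forall fun z => ?_)
    (Eventually.of_forall fun z => (hK z.1 z.2).mul_const _)
  rw [Real.norm_of_nonneg (mul_nonneg ((hdom n).nonneg _ _) (hp.1 _)), ← mul_assoc]
  exact mul_le_mul_of_nonneg_right ((hdom n).le _ _) (hp.1 _)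

end Continuum

theorem mainTheorem2
    (D T : ℝ) (hD : 0 < D) (hT : 0 < T)
    (V : ℝ → ℝ) (hV : Continuous V) (hVb : BddBelow (Set.range V))
    (x : ℝ → ℝ) (hx : ContinuousOn x (Set.Icc 0 T)) :
    -- the kernel of `N` Bayesian updates, at fixed step `ε`
    (∀ (M ε : ℝ) (xs : ℕ → ℝ) (p₀ : ℝ → ℝ) (N : ℕ),
      0 < M → 0 < ε → IsProbDensity p₀ → 1 ≤ N →
        (∀ i ∈ Finset.Icc 1 N, 0 < stepEvidence M V D ε xs p₀ i) ∧
        (∀ q, Integrable (fun q₀ => bayesKernel M V D ε xs p₀ N q q₀ * p₀ q₀) ∧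
          posterior M V D ε xs p₀ N q = ∫ q₀, bayesKernel M V D ε xs p₀ N q q₀ * p₀ q₀) ∧
        (∀ q q₀,
          Integrable (fun y : Fin (N - 1) → ℝ =>
            Real.exp (-discreteAction D V ε xs N (chain N q₀ q y))) ∧
          bayesKernel M V D ε xs p₀ N q q₀ = kernelPrefactor M V D ε xs p₀ N *
            ∫ y : Fin (N - 1) → ℝ, Real.exp (-discreteAction D V ε xs N (chain N q₀ q y)))) ∧
    -- the continuum limit `N → ∞` with `N ε = T`
    ∃ K : ℝ → ℝ → ℝ,
      (∀ q q₀, 0 < K q q₀ ∧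
        HasPathIntegral (fun N => wienerPrefactor D (T / N) N) T q q₀
          (fun γ => Real.exp (-onsagerMachlupAction D V x T γ)) (K q q₀) ∧
        Tendsto (fun N : ℕ => wienerPrefactor D (T / N) N *
            ∫ y : Fin (N - 1) → ℝ,
              Real.exp (-discreteAction D V (T / N) (fun i => x (i * (T / N))) N (chain N q₀ q y)))
          atTop (𝓝 (K q q₀))) ∧
      ∀ (M : ℝ → ℝ) (p₀ : ℝ → ℝ), (∀ ε, 0 < ε → 0 < M ε) → IsProbDensity p₀ →
        Integrable (fun z : ℝ × ℝ => K z.1 z.2 * p₀ z.2) ∧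
        0 < (∫ q, ∫ q₀, K q q₀ * p₀ q₀) ∧
        ∀ q q₀,
          Tendsto (fun N : ℕ =>
              bayesKernel (M (T / N)) V D (T / N) (fun i => x (i * (T / N))) p₀ N q q₀)
            atTop (𝓝 (K q q₀ / ∫ q', ∫ q₀', K q' q₀' * p₀ q₀')) ∧
          HasPathIntegral
            (fun N => kernelPrefactor (M (T / N)) V D (T / N) (fun i => x (i * (T / N))) p₀ N)
            T q q₀ (fun γ => Real.exp (-onsagerMachlupAction D V x T γ))
            (K q q₀ / ∫ q', ∫ q₀', K q' q₀' * p₀ q₀') := by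
  obtain ⟨lb, hlb⟩ := hVb
  have hc : ∀ q, -(-lb) ≤ V q := fun q => by rw [neg_neg]; exact hlb ⟨q, rfl⟩
  refine ⟨?_, ?_⟩
  · intro M ε xs p₀ N hM hε hp hN
    obtain ⟨n, rfl⟩ : ∃ n, N = n + 1 := ⟨N - 1, by omega⟩
    have hk := HeatDominated.iter (v := D * ε) (by positivity)
      (heatDominated_riemannKernel (D := D) hε.le hV hc xs) n
    refine ⟨fun i _ => stepEvidence_pos hM hD hε hV hc hp xs i, fun q => ?_, fun q q₀ => ?_⟩
    · simp only [bayesKernel_eq hD hε hV hc, mul_assoc, integral_const_mul]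
      exact ⟨(hk.integrable_mul_density (by positivity) hp.2.1 q).const_mul _,
        posterior_eq_integral_iterKernel hD hε hV hc hp xs n q⟩
    · have h := integral_exp_discreteAction hD hε hV hc xs n q q₀
      refine ⟨h.1, ?_⟩
      rw [bayesKernel_eq hD hε hV hc, kernelPrefactor_eq, mul_assoc, ← h.2]
      rfl
  · -- The path of the data is extended by constants to the whole line.
    set f : Set.Icc 0 T → ℝ := fun t => x t
    have hf : Continuous f := continuousOn_iff_continuous_domRestrict.1 hx
    set x' := Set.IccExtend hT.le f
    have hxx' : ∀ t ∈ Set.Icc 0 T, x' t = x t := fun t ht => Set.IccExtend_of_mem hT.le f ht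
    have hx'u : UniformContinuous x' := uniformContinuous_IccExtend hT.le hf
    obtain ⟨X, hX⟩ : ∃ X, ∀ t, |x' t| ≤ X := exists_abs_IccExtend_le hT.le hf
    have hdisc : ∀ (n : ℕ) (z : ℕ → ℝ),
        discreteAction D V (T / (n + 1 : ℕ)) (fun i => x (i * (T / (n + 1 : ℕ)))) (n + 1) z =
        discreteAction D V (T / (n + 1 : ℕ)) (fun i => x' (i * (T / (n + 1 : ℕ)))) (n + 1) z := by
      intro n z
      unfold discreteAction
      congr 1
      refine Finset.sum_congr rfl fun i hi => ?_
      have hi' : (i : ℝ) ≤ (n + 1 : ℕ) := Nat.cast_le.2 (Finset.mem_Icc.1 hi).2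
      have hmem : (i : ℝ) * (T / (n + 1 : ℕ)) ≤ T := by
        calc (i : ℝ) * (T / (n + 1 : ℕ)) ≤ (n + 1 : ℕ) * (T / (n + 1 : ℕ)) := by gcongr
          _ = T := by field_simp
      simp only [hxx' _ ⟨by positivity, hmem⟩]
    have haction : ∀ γ, onsagerMachlupAction D V x T γ = onsagerMachlupAction D V x' T γ := by
      intro γ
      refine intervalIntegral.integral_congr fun t ht => ?_
      rw [Set.uIcc_of_le hT.le] at ht
      simp only [hxx' t ht]
    choose K hK using fun b a => exists_tendsto_slicedKernel hD hT hV hc hx'u hX b a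
    have hKpos : ∀ b a, 0 < K b a := fun b a => pos_of_tendsto_slicedKernel hD hT hV hc hX (hK b a)
    have hpoly := fun b a => tendsto_slicedPolygonKernel hD hT hV hc hx'u hX (hK b a)
    have hKdom := heatDominated_of_tendsto hD hT hV hc hK
    have hDT : 0 < D * T := by positivity
    have hsliced : ∀ n b a, slicedPathIntegral (wienerPrefactor D (T / (n + 1 : ℕ)) (n + 1)) T
        (n + 1) b a (fun γ => Real.exp (-onsagerMachlupAction D V x T γ)) =
        slicedPolygonKernel D T V x' n b a := by
      intro n b a
      simp only [haction]
      exact slicedPathIntegral_wienerPrefactor hD hT hV hx'u.continuous hc n b a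
    have hriem : ∀ (n : ℕ) b a, wienerPrefactor D (T / (n + 1 : ℕ)) (n + 1) *
        ∫ y : Fin (n + 1 - 1) → ℝ, Real.exp (-discreteAction D V (T / (n + 1 : ℕ))
          (fun i => x (i * (T / (n + 1 : ℕ)))) (n + 1) (chain (n + 1) a b y)) =
        slicedKernel D T V x' n b a := by
      intro n b a
      simp only [hdisc]
      exact (integral_exp_discreteAction hD (by positivity) hV hc _ n b a).2
    refine ⟨K, fun q q₀ => ⟨hKpos q q₀, ?_, ?_⟩, fun M p₀ hM hp => ?_⟩
    · refine (tendsto_add_atTop_iff_nat 1).1 ((hpoly q q₀).congr fun n => ?_)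
      exact (hsliced n q q₀).symm
    · refine (tendsto_add_atTop_iff_nat 1).1 ((hK q q₀).congr fun n => ?_)
      exact (hriem n q q₀).symm
    · have hKint := hKdom.integrable_prod_mul_density hDT hp.2.1
      have hZ : 0 < ∫ q, ∫ q₀, K q q₀ * p₀ q₀ :=
        integral_pos_of_pos (fun q => integral_mul_density_pos hp (hKpos q)
          (hKdom.integrable_mul_density hDT hp.2.1 q)) hKint.integral_prod_left
      have hlim := (tendsto_integral_slicedKernel hD hT hV hc hp hK).inv₀ hZ.ne'
      have hprod : ∀ n : ℕ, ∏ i ∈ Finset.Icc 1 (n + 1), M (T / (n + 1 : ℕ)) /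
          stepEvidence (M (T / (n + 1 : ℕ))) V D (T / (n + 1 : ℕ))
            (fun i => x (i * (T / (n + 1 : ℕ)))) p₀ i =
          (∫ q, ∫ q₀, slicedKernel D T V x' n q q₀ * p₀ q₀)⁻¹ := by
        intro n
        have hε : 0 < T / (n + 1 : ℕ) := by positivity
        rw [prod_div_stepEvidence_eq (hM _ hε) hD hε hV hc hp]
        simp only [← hriem, ← (integral_exp_discreteAction hD hε hV hc _ n _ _).2]
        rfl
      refine ⟨hKint, hZ, fun q q₀ => ⟨?_, ?_⟩⟩
      · refine (tendsto_add_atTop_iff_nat 1).1 ?_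
        rw [div_eq_inv_mul]
        refine (hlim.mul (hK q q₀)).congr fun n => ?_
        rw [bayesKernel_eq hD (by positivity) hV hc, hprod, ← hriem,
          ← (integral_exp_discreteAction hD (by positivity) hV hc _ n _ _).2]
        rfl
      · refine (tendsto_add_atTop_iff_nat 1).1 ?_
        rw [div_eq_inv_mul]
        refine (hlim.mul (hpoly q q₀)).congr fun n => ?_
        simp only [← hsliced, kernelPrefactor_eq, hprod, slicedPathIntegral, mul_assoc]
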